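/- Theorem. Let $K\ge 1$. For $i=1,\dots,K$ let arm $i$ have a finite state space $S^i$, an irreducible and aperiodic transition probability matrix $P^i=(p^i_{xy})$ with stationary distribution $\pi^i$, and rewards $r^i_x>0$, $x\in S^i$. Let $(P^i)'$, $(p^i)'_{xy}=\pi^i_y p^i_{yx}/\pi^i_x$, be the adjoint of $P^i$ on $\ell^2(\pi^i)$, and assume that the multiplicative symmetrization $\hat P^i=(P^i)'P^i$ is irreducible; let $\epsilon^i$ be $1$ minus the second largest eigenvalue of $\hat P^i$ ($\epsilon^i=1$ if $|S^i|=1$). Put $\mu^i=\sum_{x\in S^i} r^i_x\pi^i_x$, and number the arms so that $\mu^1\ge\mu^2\ge\dots\ge\mu^K$. Let $$\beta=\sum_{t\ge1}t^{-2},\quad \pi_{\min}=\min_{i,x}\pi^i_x,\quad r_{\max}=\max_{i,x} r^i_x,\quad S_{\max}=\max_i|S^i|,\quad \hat\pi_{\max}=\max_{i,x}\max\{\pi^i_x,1-\pi^i_x\},\quad \epsilon_{\min}=\min_i\epsilon^i .$$ The arms are independent and rested: when arm $i$ is played for the $s$-th time the player receives $r^i_{X^i_s}$, where $(X^i_s)_{s\ge1}$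 is a Markov chain with transition matrix $P^i$ and an arbitrary initial distribution, and these chains are independent of each other. Let $1\le M\le K$, with $\mu^M>\mu^{M+1}$ if $M<K$. The policy UCB-M with exploration constant $L$ plays a set $A(t)$ of $M$ arms in each slot $t=1,2,\dots$; in the first $K$ slots it plays every arm $M$ times; and for every $t\ge K$ it plays in slot $t+1$ the $M$ arms with the highest indices $$\frac1{T^i(t)}\sum_{s=1}^{T^i(t)} r^i_{X^i_s}+\sqrt{\frac{L\ln t}{T^i(t)}},$$ where $T^i(t)$ is the number of plays of arm $i$ in the slots $1,\dots,t$. The initial schedule and the tie-breaking are arbitrary: they may use the observed history and a random seed independent of the arms. The regret is $R(n)=n\sum_{j=1}^M\mu^j-E\big[\sum_{t=1}^n\sum_{i\in A(t)} r^i_{X^i_{T^i(t)}}\big]$. Then there is a constant $C_{\mathbf{S,P,r}}$ that depends only on the state spaces, transition matrices and rewards of the arms (in particular not on $n$, $M$, $L$, the initial distributions or the tie-breaking) such that, whenever $L\ge 112\,S_{\max}^2\,r_{\max}^2\,\hat\pi_{\max}^2/\epsilon_{\min}$, for all $n\ge1$ $$R(n)\le 4L\ln n\sum_{i>M}\frac{\mu^1-\mu^i}{(\mu^M-\mu^i)^2}+\sum_{i>M}(\mu^1-\mu^i)\Big(M+\sum_{j=1}^M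 C_{i,j}\Big)+C_{\mathbf{S,P,r}},\qquad C_{i,j}=\frac{(|S^i|+|S^j|)\,\beta}{\pi_{\min}} .$$ -/

import Mathlib

open MeasureTheory ProbabilityTheory

noncomputable section

namespace MarkovBandit

section Chain

variable {S : Type*} [Fintype S] [DecidableEq S]

/-- `π` is a stationary probability distribution of the matrix `P`. -/
structure IsStationary (P : Matrix S S ℝ) (π : S → ℝ) : Prop where
  nonneg : ∀ x, 0 ≤ π x
  sum_eq_one : ∑ x, π x = 1
  stationary : ∀ y, ∑ x, π x * P x y = π y

/-- Every state has period one: the greatest common divisor of its return times is `1`. -/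
def IsAperiodic (P : Matrix S S ℝ) : Prop :=
  ∀ (x : S) (d : ℕ), (∀ n : ℕ, 0 < n → 0 < (P ^ n) x x → d ∣ n) → d = 1

/-- The adjoint `P'` of `P` on `ℓ²(π)`: `P'_{xy} = π_y P_{yx} / π_x`. -/
def adjointMatrix (P : Matrix S S ℝ) (π : S → ℝ) : Matrix S S ℝ :=
  Matrix.of fun x y => π y * P y x / π x

/-- The multiplicative symmetrization `P' P` of `P`. -/
def multSymm (P : Matrix S S ℝ) (π : S → ℝ) : Matrix S S ℝ :=
  adjointMatrix P π * P

/-- `1 - λ₂`, with `λ₂` the second largest eigenvalue of the multiplicative symmetrization.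
The largest eigenvalue of that stochastic matrix is `1`, and it is simple as the matrix is assumed
irreducible, so that `λ₂` is the largest of the other eigenvalues. When there is no other eigenvalue
(a single state) the value is `1`. -/
def eigenGap (P : Matrix S S ℝ) (π : S → ℝ) : ℝ :=
  1 - sSup {lam : ℝ | Module.End.HasEigenvalue (Matrix.toLin' (multSymm P π)) lam ∧ lam ≠ 1}

/-- The mean reward under the stationary distribution. -/
def meanReward (π r : S → ℝ) : ℝ := ∑ x, r x * π x

/-- The standing condition on one arm with transition matrix `P`, stationary distribution `π` and
rewards `r`. -/
structure ArmCondition (P : Matrix S S ℝ) (π r : S → ℝ) : Prop where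
  stochastic : P ∈ Matrix.rowStochastic ℝ S
  irreducible : P.IsIrreducible
  aperiodic : IsAperiodic P
  stationary : IsStationary P π
  multSymm_irreducible : (multSymm P π).IsIrreducible
  reward_pos : ∀ x, 0 < r x

/-- The process `X 0, X 1, …` is a time-homogeneous Markov chain with transition matrix `P` and an
arbitrary initial distribution:
`Pr(X₀ = x₀, …, Xₙ₊₁ = xₙ₊₁) = Pr(X₀ = x₀, …, Xₙ = xₙ) P(xₙ, xₙ₊₁)`. -/
structure IsMarkovChain {Ω : Type*} [MeasurableSpace Ω] [MeasurableSpace S]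
    (P : Matrix S S ℝ) (X : ℕ → Ω → S) (Pr : Measure Ω) : Prop where
  measurable : ∀ t, Measurable (X t)
  markov : ∀ (n : ℕ) (x : ℕ → S),
    Pr.real {ω | ∀ k ≤ n + 1, X k ω = x k} =
      Pr.real {ω | ∀ k ≤ n, X k ω = x k} * P (x n) (x (n + 1))

end Chain

section Constants

variable {K : ℕ} {S : Fin K → Type*} [∀ i, Fintype (S i)] [∀ i, DecidableEq (S i)]

/-- `π_min`, the least stationary probability of a state of an arm. -/
def piMin (π : ∀ i, S i → ℝ) : ℝ := ⨅ p : Σ i, S i, π p.1 p.2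

/-- `π̂_max = max_{i, x} max (π^i_x) (1 - π^i_x)`. -/
def piHatMax (π : ∀ i, S i → ℝ) : ℝ := ⨆ p : Σ i, S i, max (π p.1 p.2) (1 - π p.1 p.2)

/-- `r_max`, the largest reward. -/
def rMax (r : ∀ i, S i → ℝ) : ℝ := ⨆ p : Σ i, S i, r p.1 p.2

/-- `S_max`, the largest number of states of an arm. -/
def sMax (S : Fin K → Type*) [∀ i, Fintype (S i)] : ℕ :=
  Finset.univ.sup fun i => Fintype.card (S i)

/-- `ε_min`, the least eigenvalue gap. -/
def epsMin (P : ∀ i, Matrix (S i) (S i) ℝ) (π : ∀ i, S i → ℝ) : ℝ :=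
  ⨅ i, eigenGap (P i) (π i)

/-- `β = ∑_{t ≥ 1} 1 / t²`. -/
def beta : ℝ := ∑' t : ℕ, 1 / ((t : ℝ) + 1) ^ 2

/-- `C_{i,j} = (|Sⁱ| + |Sʲ|) β / π_min`. -/
def pairConst (π : ∀ i, S i → ℝ) (i j : Fin K) : ℝ :=
  ((Fintype.card (S i) : ℝ) + Fintype.card (S j)) * beta / piMin π

end Constants

section Policy

variable {K : ℕ} {S : Fin K → Type*} {Ξ : Type*} [MeasurableSpace Ξ]

/-- The record of the past slots, most recent slot first. The entry of a slot gives, for every arm,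
the state observed in that slot if the arm was played, and `none` if it was not. -/
abbrev History {K : ℕ} (S : Fin K → Type*) : Type _ := List (∀ i, Option (S i))

/-- A policy: from a random seed (for randomized choices) and the observed history it selects the
set of arms to be played in the next slot. -/
structure Policy {K : ℕ} (S : Fin K → Type*) (Ξ : Type*) [MeasurableSpace Ξ] where
  select : Ξ → History S → Finset (Fin K)
  measurable_select : ∀ (h : History S) (B : Finset (Fin K)), MeasurableSet {u | select u h = B}

/-- The number of plays of arm `i` that a history records. -/
def numPlays (h : History S) (i : Fin K) : ℕ := h.countP fun o => (o i).isSome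

/-- The history after `t` slots, if the policy `α` has seed `u` and, for every arm `i`, the states
met in the successive plays of arm `i` are `x i 0, x i 1, …`. The arms are rested: arm `i` moves
along its path only when it is played. -/
def history (α : Policy S Ξ) (u : Ξ) (x : ∀ i, ℕ → S i) : ℕ → History S
  | 0 => []
  | t + 1 =>
    (fun i => if i ∈ α.select u (history α u x t)
      then some (x i (numPlays (history α u x t) i)) else none) :: history α u x t

/-- `A(t + 1)`, the set of arms played in slot `t + 1`. -/
def played (α : Policy S Ξ) (u : Ξ) (x : ∀ i, ℕ → S i) (t : ℕ) : Finset (Fin K) :=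
  α.select u (history α u x t)

/-- `Tⁱ(t)`, the number of plays of arm `i` in the slots `1, …, t`. -/
def plays (α : Policy S Ξ) (u : Ξ) (x : ∀ i, ℕ → S i) (t : ℕ) (i : Fin K) : ℕ :=
  numPlays (history α u x t) i

/-- The total reward collected in the slots `1, …, n`. -/
def totalReward (α : Policy S Ξ) (r : ∀ i, S i → ℝ) (u : Ξ) (x : ∀ i, ℕ → S i) (n : ℕ) : ℝ :=
  ∑ t ∈ Finset.range n, ∑ i ∈ played α u x t, r i (x i (plays α u x t i))

/-- The mean of the rewards of the first `k` plays of arm `i`. -/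
def sampleMean (r : ∀ i, S i → ℝ) (x : ∀ i, ℕ → S i) (i : Fin K) (k : ℕ) : ℝ :=
  (∑ s ∈ Finset.range k, r i (x i s)) / k

/-- The index `gⁱ_{t,k} = r̄ⁱ(k) + √(L ln t / k)`. -/
def ucbIndex (L : ℝ) (r : ∀ i, S i → ℝ) (x : ∀ i, ℕ → S i) (t : ℕ) (i : Fin K) (k : ℕ) : ℝ :=
  sampleMean r x i k + √(L * Real.log t / k)

/-- The policy `α` is a version of UCB-M with exploration constant `L`: it plays `M` arms in every
slot, every arm is played `M` times in the first `K` slots, and for every `t ≥ K` the `M` arms with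
the highest indices at time `t` are played in slot `t + 1`. The schedule of the first `K` slots and
the rule for breaking ties are arbitrary. -/
structure IsUCBM (α : Policy S Ξ) (r : ∀ i, S i → ℝ) (M : ℕ) (L : ℝ) : Prop where
  card_played : ∀ u x t, (played α u x t).card = M
  initial : ∀ u x i, plays α u x K i = M
  highest : ∀ u x t, K ≤ t → ∀ i ∈ played α u x t, ∀ j ∉ played α u x t,
    ucbIndex L r x t j (plays α u x t j) ≤ ucbIndex L r x t i (plays α u x t i)

variable {Ω : Type*} [MeasurableSpace Ω]

/-- The arms are mutually independent Markov chains `X i` with transition matrices `P i`, and the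
seed `ξ` of the policy is independent of them. -/
structure IsBanditModel [∀ i, Fintype (S i)] [∀ i, DecidableEq (S i)] [∀ i, MeasurableSpace (S i)]
    (P : ∀ i, Matrix (S i) (S i) ℝ) (X : ∀ i, ℕ → Ω → S i) (ξ : Ω → Ξ) (Pr : Measure Ω) : Prop where
  chain : ∀ i, IsMarkovChain (P i) (X i) Pr
  indep_arms : iIndepFun (fun i ω => fun s : ℕ => X i s ω) Pr
  measurable_seed : Measurable ξ
  indep_seed : IndepFun ξ (fun ω => fun (i : Fin K) (s : ℕ) => X i s ω) Pr

/-- The regret `R(n) = n ∑_{j ≤ M} μʲ - E[total reward in the slots 1, …, n]`. Arms are numbered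
from `0` here, so the `M` best arms are those whose number is less than `M`. -/
def regret [∀ i, Fintype (S i)] (α : Policy S Ξ) (π r : ∀ i, S i → ℝ) (X : ∀ i, ℕ → Ω → S i)
    (ξ : Ω → Ξ) (Pr : Measure Ω) (M n : ℕ) : ℝ :=
  n * ∑ j : Fin K with j.val < M, meanReward (π j) (r j) -
    ∫ ω, totalReward α r (ξ ω) (fun i s => X i s ω) n ∂Pr

end Policy

end MarkovBandit

end

/-!
The regret is controlled by two estimates, each of which loses a constant that depends on the arms
alone.

*From regret to play counts.* For every arm let `h` solve the Poisson equation `r - μ = h - P h`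
(`ArmCondition.exists_poisson`). Along the plays of arm `i` the collected reward is then
`μ i` per play, plus the bounded telescoping term `h (X₀) - h (X_T)`, plus increments
`h (X_{s+1}) - (P h) (X_s)`. Whether the `(s+1)`-st play of the arm takes place in a given slot is
determined by the first `s` states of the arm, the other arms and the seed, so these increments
have mean zero (`IsBanditModel.integral_increment_eq_zero`). Hence the regret is at most
`∑_{i ≥ M} (μ₀ - μ i) E[Tⁱ(n)]` up to a constant (`IsBanditModel.regret_le`).

*Bounding the play counts.* Once arm `i ≥ M` has been played `4 L ln n / (μ_{M-1} - μ i)²` times,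
it is played again only if its own sample mean exceeds its expectation by the confidence radius or
the sample mean of one of the best `M` arms falls below its expectation by as much
(`IsUCBM.exists_deviation`). Such a deviation at time `t` has probability `O(t⁻³)` for each of the
at most `t` sample sizes, and `∑ t · t⁻³` converges (`IsUCBM.integral_plays_le`).

The deviation bound is a Chernoff bound for chains that need not be reversible
(`ArmCondition.real_sum_ge_le`). Exponential moments are matrix elements of powers of `e^φ P`
(`IsMarkovChain.integral_exp_sum_mul`). As `‖P g‖² = ⟨g, P' P g⟩`, the gap `ε` of `P' P` makes `P`
a contraction with factor `√(1 - ε)` on mean-zero functions of `ℓ²(π)`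
(`ArmCondition.sum_sq_mulVec_le_gap`), and a perturbation argument gives
`‖e^φ P‖² ≤ 1 + 10 τ² / ε` when `|φ| ≤ τ ≤ ε / 8` and `φ` has mean zero
(`ArmCondition.sum_sq_exp_mul_mulVec_le`). The exponent obtained is `3 m γ² ε / (64 R²)` for a
deviation `γ` of the mean of `m` terms bounded by `R`. Since `S_max π̂_max ≥ 1`, the assumption on `L`
gives `L ε ≥ 112 r_max²`, where `64 r_max²` is enough for the rate `t⁻³`.
-/

namespace MarkovBandit

/-! ### The spectral gap of the multiplicative symmetrization -/

section Gap

lemma sum_pi_sq_pos {S : Type*} [Fintype S] {π : S → ℝ} (hπ : ∀ x, 0 < π x) {v : S → ℝ}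
    (hv : v ≠ 0) : 0 < ∑ x, π x * v x ^ 2 := by
  obtain ⟨x, hx⟩ := Function.ne_iff.1 hv
  exact Finset.sum_pos' (fun z _ => mul_nonneg (hπ z).le (sq_nonneg _))
    ⟨x, Finset.mem_univ x, mul_pos (hπ x) (by simpa [sq_pos_iff] using hx)⟩

variable {S : Type*} [Fintype S] [DecidableEq S]

/-- A harmonic function of an irreducible stochastic matrix is constant: the value at a maximum
point is an average of values that do not exceed it. -/
lemma eq_of_mulVec_eq_self {Q : Matrix S S ℝ} (hsum : ∀ x, ∑ y, Q x y = 1)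
    (hirr : Q.IsIrreducible) {v : S → ℝ} (hv : Q.mulVec v = v) (a b : S) : v a = v b := by
  have hpow : ∀ n : ℕ, (∀ x, ∑ y, (Q ^ n) x y = 1) ∧ (Q ^ n).mulVec v = v := by
    intro n
    induction n with
    | zero => simp [Matrix.one_apply]
    | succ n ih =>
      refine ⟨fun x => ?_, ?_⟩
      · simp_rw [pow_succ, Matrix.mul_apply]
        rw [Finset.sum_comm]
        simp_rw [← Finset.mul_sum, hsum, mul_one, ih.1]
      · rw [pow_succ, ← Matrix.mulVec_mulVec, hv, ih.2]
  have : Nonempty S := ⟨a⟩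
  obtain ⟨m, hm⟩ := Finite.exists_max v
  have key : ∀ y, v y = v m := by
    intro y
    obtain ⟨n, -, hn⟩ := (Matrix.isIrreducible_iff_exists_pow_pos hirr.nonneg).1 hirr m y
    have hnn : ∀ z, 0 ≤ (Q ^ n) m z := fun z => Matrix.pow_apply_nonneg hirr.nonneg n m z
    have h0 : ∑ z, (Q ^ n) m z * (v m - v z) = 0 := by
      have h1 : ∑ z, (Q ^ n) m z * v z = v m := congrFun (hpow n).2 m
      simp_rw [mul_sub]
      rw [Finset.sum_sub_distrib, ← Finset.sum_mul, (hpow n).1, h1, one_mul, sub_self]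
    have h1 := (Finset.sum_eq_zero_iff_of_nonneg
      (fun z _ => mul_nonneg (hnn z) (sub_nonneg.2 (hm z)))).1 h0 y (Finset.mem_univ y)
    have := (mul_eq_zero.1 h1).resolve_left hn.ne'
    linarith
  rw [key a, key b]

variable {P : Matrix S S ℝ} {π r : S → ℝ}

lemma ArmCondition.sum_row (h : ArmCondition P π r) (x : S) : ∑ y, P x y = 1 :=
  Matrix.sum_row_of_mem_rowStochastic h.stochastic x

lemma ArmCondition.pi_pos (h : ArmCondition P π r) (y : S) : 0 < π y := by
  obtain ⟨x, -, hx⟩ : ∃ x ∈ Finset.univ, 0 < π x := by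
    refine Finset.exists_lt_of_sum_lt (f := fun _ => (0 : ℝ)) ?_
    simp [h.stationary.sum_eq_one]
  obtain ⟨n, -, hn⟩ :=
    (Matrix.isIrreducible_iff_exists_pow_pos h.irreducible.nonneg).1 h.irreducible x y
  have hstat : ∀ n : ℕ, Matrix.vecMul π (P ^ n) = π := by
    intro n
    induction n with
    | zero => simp
    | succ n ih =>
      rw [pow_succ, ← Matrix.vecMul_vecMul, ih]
      exact funext fun y => h.stationary.stationary y
  rw [← hstat n]
  exact Finset.sum_pos' (fun z _ => mul_nonneg (h.stationary.nonneg z)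
    (Matrix.pow_apply_nonneg h.irreducible.nonneg n z y))
    ⟨x, Finset.mem_univ x, mul_pos hx hn⟩

lemma ArmCondition.sum_pi_mulVec (h : ArmCondition P π r) (g : S → ℝ) :
    ∑ x, π x * P.mulVec g x = ∑ x, π x * g x := by
  simp only [Matrix.mulVec, dotProduct, Finset.mul_sum]
  rw [Finset.sum_comm]
  simp_rw [← mul_assoc, ← Finset.sum_mul, h.stationary.stationary]

lemma ArmCondition.multSymm_mulVec (h : ArmCondition P π r) (g : S → ℝ) (x : S) :
    π x * (multSymm P π).mulVec g x = ∑ z, π z * P z x * P.mulVec g z := by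
  rw [multSymm, ← Matrix.mulVec_mulVec]
  simp only [adjointMatrix, Matrix.mulVec, dotProduct, Matrix.of_apply]
  rw [Finset.mul_sum]
  refine Finset.sum_congr rfl fun z _ => ?_
  have := (h.pi_pos x).ne'
  field_simp

lemma ArmCondition.multSymm_sum_row (h : ArmCondition P π r) (x : S) :
    ∑ y, multSymm P π x y = 1 := by
  have h1 := h.multSymm_mulVec (fun _ => 1) x
  have h2 : ∀ z, P.mulVec (fun _ => (1 : ℝ)) z = 1 := fun z => by
    simp [Matrix.mulVec, dotProduct, h.sum_row]
  simp_rw [h2, mul_one, h.stationary.stationary] at h1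
  have h3 := mul_left_cancel₀ (h.pi_pos x).ne' (h1.trans (mul_one _).symm)
  simpa [Matrix.mulVec, dotProduct] using h3

/-- The quadratic form of the multiplicative symmetrization: `⟨g, P' P g⟩ = ‖P g‖²`. -/
lemma ArmCondition.sum_mul_multSymm (h : ArmCondition P π r) (g : S → ℝ) :
    ∑ x, g x * (π x * (multSymm P π).mulVec g x) = ∑ z, π z * P.mulVec g z ^ 2 := by
  simp_rw [h.multSymm_mulVec, Finset.mul_sum]
  rw [Finset.sum_comm]
  refine Finset.sum_congr rfl fun z _ => ?_
  have h1 : P.mulVec g z = ∑ x, P z x * g x := rfl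
  calc _ = π z * P.mulVec g z * ∑ x, P z x * g x := by
        rw [Finset.mul_sum]
        exact Finset.sum_congr rfl fun x _ => by ring
    _ = _ := by rw [← h1]; ring

lemma ArmCondition.sum_sq_mulVec_le (h : ArmCondition P π r) (g : S → ℝ) :
    ∑ z, π z * P.mulVec g z ^ 2 ≤ ∑ z, π z * g z ^ 2 := by
  have h1 : ∀ z, P.mulVec g z ^ 2 ≤ P.mulVec (fun x => g x ^ 2) z := fun z =>
    Real.pow_arith_mean_le_arith_mean_pow_of_even _ _ _
      (fun x _ => h.irreducible.nonneg z x) (h.sum_row z) even_two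
  calc _ ≤ ∑ z, π z * P.mulVec (fun x => g x ^ 2) z :=
        Finset.sum_le_sum fun z _ => mul_le_mul_of_nonneg_left (h1 z) (h.pi_pos z).le
    _ = _ := h.sum_pi_mulVec _

lemma hasEigenvalue_toLin'_iff {Q : Matrix S S ℝ} {lam : ℝ} :
    Module.End.HasEigenvalue (Matrix.toLin' Q) lam ↔ ∃ v ≠ 0, Q.mulVec v = lam • v := by
  constructor
  · intro hl
    obtain ⟨v, hv⟩ := hl.exists_hasEigenvector
    exact ⟨v, hv.2, by simpa using hv.apply_eq_smul⟩
  · rintro ⟨v, hv0, hv⟩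
    exact Module.End.hasEigenvalue_of_hasEigenvector (x := v)
      ⟨Module.End.mem_eigenspace_iff.2 (by simpa using hv), hv0⟩

lemma ArmCondition.eigenvalue_mem_Icc (h : ArmCondition P π r) {lam : ℝ}
    (hl : Module.End.HasEigenvalue (Matrix.toLin' (multSymm P π)) lam) :
    0 ≤ lam ∧ lam ≤ 1 := by
  obtain ⟨v, hv0, hv⟩ := hasEigenvalue_toLin'_iff.1 hl
  have h1 := h.sum_mul_multSymm v
  have h2 : ∑ x, v x * (π x * (multSymm P π).mulVec v x) = lam * ∑ x, π x * v x ^ 2 := by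
    rw [hv, Finset.mul_sum]
    exact Finset.sum_congr rfl fun x _ => by simp; ring
  have h3 := sum_pi_sq_pos h.pi_pos hv0
  have h4 := h.sum_sq_mulVec_le v
  have h5 : 0 ≤ ∑ z, π z * P.mulVec v z ^ 2 :=
    Finset.sum_nonneg fun z _ => mul_nonneg (h.pi_pos z).le (sq_nonneg _)
  rw [← h1, h2] at h4 h5
  exact ⟨nonneg_of_mul_nonneg_left h5 h3, le_of_mul_le_mul_right (by linarith) h3⟩

lemma finite_eigenvalues_ne_one (P : Matrix S S ℝ) (π : S → ℝ) :
    {lam : ℝ | Module.End.HasEigenvalue (Matrix.toLin' (multSymm P π)) lam ∧ lam ≠ 1}.Finite :=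
  (Module.End.finite_hasEigenvalue _).subset fun _ hl => hl.1

lemma ArmCondition.eigenGap_pos (h : ArmCondition P π r) : 0 < eigenGap P π := by
  rw [eigenGap, sub_pos]
  rcases Set.eq_empty_or_nonempty
    {lam : ℝ | Module.End.HasEigenvalue (Matrix.toLin' (multSymm P π)) lam ∧ lam ≠ 1} with he | hne
  · rw [he, Real.sSup_empty]; exact one_pos
  · have := hne.csSup_mem (finite_eigenvalues_ne_one P π)
    exact lt_of_le_of_ne (h.eigenvalue_mem_Icc this.1).2 this.2

lemma ArmCondition.eigenGap_le_one (h : ArmCondition P π r) : eigenGap P π ≤ 1 := by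
  rw [eigenGap, sub_le_self_iff]
  exact Real.sSup_nonneg fun lam hl => (h.eigenvalue_mem_Icc hl.1).1

/-- `P` contracts the mean-zero functions of `ℓ²(π)` by the factor `√λ₂ = √(1 - ε)`. With
`C = D^{1/2} P D^{-1/2}`, `D = diag π`, this says that the symmetric matrix
`λ₂ + √π √πᵀ - Cᵀ C` is positive semidefinite, which is seen on its eigenvectors: one that is
not orthogonal to `√π` has the eigenvalue `λ₂`, and one orthogonal to `√π` comes from an
eigenvector of `P' P` that is not constant. -/
lemma ArmCondition.sum_sq_mulVec_le_gap (h : ArmCondition P π r) {g : S → ℝ}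
    (hg : ∑ x, π x * g x = 0) :
    ∑ z, π z * P.mulVec g z ^ 2 ≤ (1 - eigenGap P π) * ∑ z, π z * g z ^ 2 := by
  set l2 : ℝ := 1 - eigenGap P π with hl2
  have hl2' : l2 = sSup {lam : ℝ |
      Module.End.HasEigenvalue (Matrix.toLin' (multSymm P π)) lam ∧ lam ≠ 1} := by
    rw [hl2, eigenGap]; ring
  have hl2nn : 0 ≤ l2 := by have := h.eigenGap_le_one; linarith
  set q : S → ℝ := fun x => √(π x) with hq
  have hqpos : ∀ x, 0 < q x := fun x => Real.sqrt_pos.2 (h.pi_pos x)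
  have hqq : ∀ x, q x * q x = π x := fun x => Real.mul_self_sqrt (h.pi_pos x).le
  set B : Matrix S S ℝ := Matrix.of fun x y =>
    (if x = y then l2 else 0) + q x * q y - ∑ z, π z * P z x * P z y / (q x * q y) with hB
  have hherm : B.IsHermitian := by
    ext x y
    simp only [hB, Matrix.conjTranspose_apply, Matrix.of_apply, star_trivial]
    congr 1
    · rw [mul_comm (q y)]; simp [eq_comm]
    · exact Finset.sum_congr rfl fun z _ => by ring
  -- the action of `B` on `q u`, in terms of the action of `P' P` on `u`
  have hBmul : ∀ u : S → ℝ, ∀ x, B.mulVec (fun y => q y * u y) x =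
      l2 * (q x * u x) + q x * (∑ y, π y * u y) - q x * (multSymm P π).mulVec u x := by
    intro u x
    have e1 : q x * (multSymm P π).mulVec u x =
        ∑ y, (∑ z, π z * P z x * P z y / (q x * q y)) * (q y * u y) := by
      have h1 := h.multSymm_mulVec u x
      have h2 : q x * (multSymm P π).mulVec u x
          = (∑ z, π z * P z x * P.mulVec u z) / q x := by
        rw [← h1, ← hqq x, eq_div_iff (hqpos x).ne']; ring
      rw [h2, Finset.sum_div]
      simp_rw [Finset.sum_mul]
      rw [Finset.sum_comm]
      refine Finset.sum_congr rfl fun z _ => ?_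
      rw [Matrix.mulVec, dotProduct, Finset.mul_sum, Finset.sum_div]
      refine Finset.sum_congr rfl fun y _ => ?_
      have h3 := (hqpos x).ne'
      have h4 := (hqpos y).ne'
      field_simp
    rw [e1, Finset.mul_sum]
    simp only [Matrix.mulVec, dotProduct, hB, Matrix.of_apply, sub_mul, add_mul,
      Finset.sum_sub_distrib, Finset.sum_add_distrib]
    congr 2
    · simp
    · exact Finset.sum_congr rfl fun y _ => by rw [← hqq y]; ring
  have hpsd : B.PosSemidef := by
    refine hherm.posSemidef_iff_eigenvalues_nonneg.2 fun j => ?_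
    set v : S → ℝ := ⇑(hherm.eigenvectorBasis j) with hv
    have hv0 : v ≠ 0 := by
      intro h0
      have := hherm.eigenvectorBasis.orthonormal.ne_zero j
      exact this (by ext x; exact congrFun h0 x)
    have hBv : B.mulVec v = hherm.eigenvalues j • v := hherm.mulVec_eigenvectorBasis j
    set m := hherm.eigenvalues j with hm
    set u : S → ℝ := fun x => v x / q x with hu
    have hvu : v = fun y => q y * u y := by
      funext y; rw [hu]; have := (hqpos y).ne'; field_simp
    have hu0 : u ≠ 0 := by
      rintro h0
      apply hv0
      rw [hvu, h0]; funext y; simp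
    have hEq : ∀ x, (multSymm P π).mulVec u x = (l2 - m) * u x + ∑ y, π y * u y := by
      intro x
      have h1 := congrFun hBv x
      rw [hvu, hBmul u x] at h1
      simp only [Pi.smul_apply, smul_eq_mul] at h1
      have := (hqpos x).ne'
      apply mul_left_cancel₀ this
      linarith
    have hmean : (l2 - m) * ∑ y, π y * u y = 0 := by
      have h1 : ∑ x, π x * (multSymm P π).mulVec u x = ∑ x, π x * u x := by
        simp_rw [h.multSymm_mulVec]
        rw [Finset.sum_comm]
        simp_rw [mul_assoc, ← Finset.mul_sum, ← Finset.sum_mul, h.sum_row, one_mul]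
        exact h.sum_pi_mulVec u
      simp_rw [hEq, mul_add] at h1
      rw [Finset.sum_add_distrib, ← Finset.sum_mul, h.stationary.sum_eq_one] at h1
      have h2 : ∑ x, π x * ((l2 - m) * u x) = ∑ x, (l2 - m) * (π x * u x) :=
        Finset.sum_congr rfl fun x _ => by ring
      rw [h2, ← Finset.mul_sum] at h1
      linarith
    change 0 ≤ m
    rcases mul_eq_zero.1 hmean with h0 | h0
    · linarith
    · have heig : Module.End.HasEigenvalue (Matrix.toLin' (multSymm P π)) (l2 - m) := by
        refine hasEigenvalue_toLin'_iff.2 ⟨u, hu0, ?_⟩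
        funext x; rw [hEq x, h0]; simp
      have hne : l2 - m ≠ 1 := by
        intro h1
        have hfix : (multSymm P π).mulVec u = u := by
          funext x; rw [hEq x, h0, h1]; simp
        have hc := eq_of_mulVec_eq_self h.multSymm_sum_row h.multSymm_irreducible hfix
        apply hu0
        funext x
        have h2 : ∑ y, π y * u y = u x := by
          rw [Finset.sum_congr rfl fun y _ => by rw [hc y x], ← Finset.sum_mul,
            h.stationary.sum_eq_one, one_mul]
        rw [← h2, h0]; rfl
      have : l2 - m ≤ l2 := by
        conv_rhs => rw [hl2']
        exact le_csSup (finite_eigenvalues_ne_one P π).bddAbove ⟨heig, hne⟩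
      linarith
  have hfin := hpsd.dotProduct_mulVec_nonneg (fun y => q y * g y)
  rw [dotProduct] at hfin
  simp_rw [hBmul g, hg] at hfin
  have e2 : ∑ x, star (fun y => q y * g y) x *
      (l2 * (q x * g x) + q x * 0 - q x * (multSymm P π).mulVec g x)
      = l2 * ∑ z, π z * g z ^ 2 - ∑ x, g x * (π x * (multSymm P π).mulVec g x) := by
    rw [Finset.mul_sum, ← Finset.sum_sub_distrib]
    refine Finset.sum_congr rfl fun x _ => ?_
    simp only [Pi.star_apply, star_trivial, ← hqq x]
    ring
  rw [e2, h.sum_mul_multSymm] at hfin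
  linarith

/-- The Poisson equation `h - P h = f` is solvable for mean-zero `f`: the map
`g ↦ g - P g + π(g)` is injective, hence surjective. -/
lemma ArmCondition.exists_poisson (h : ArmCondition P π r) {f : S → ℝ}
    (hf : ∑ x, π x * f x = 0) : ∃ g : S → ℝ, ∀ x, f x = g x - P.mulVec g x := by
  let T : (S → ℝ) →ₗ[ℝ] (S → ℝ) :=
    { toFun := fun g x => g x - P.mulVec g x + ∑ y, π y * g y
      map_add' := fun a b => by
        funext x
        simp only [Matrix.mulVec_add, Pi.add_apply, mul_add, Finset.sum_add_distrib]; ring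
      map_smul' := fun c a => by
        funext x
        simp only [Matrix.mulVec_smul, Pi.smul_apply, smul_eq_mul, RingHom.id_apply, mul_add,
          mul_sub, Finset.mul_sum]
        congr 1
        exact Finset.sum_congr rfl fun y _ => by ring }
  have hT : ∀ g x, T g x = g x - P.mulVec g x + ∑ y, π y * g y := fun _ _ => rfl
  have hmean : ∀ g, ∑ x, π x * T g x = ∑ y, π y * g y := by
    intro g
    simp_rw [hT, mul_add, mul_sub]
    rw [Finset.sum_add_distrib, Finset.sum_sub_distrib, h.sum_pi_mulVec, ← Finset.sum_mul,
      h.stationary.sum_eq_one]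
    ring
  have hinj : Function.Injective T := by
    refine (injective_iff_map_eq_zero T).2 fun g hg => ?_
    have h0 : ∑ y, π y * g y = 0 := by rw [← hmean g, hg]; simp
    have hfix : P.mulVec g = g := by
      funext x
      have := congrFun hg x
      rw [hT, h0] at this
      simp only [Pi.zero_apply] at this
      linarith
    have hc := eq_of_mulVec_eq_self h.sum_row h.irreducible hfix
    funext x
    have h2 : ∑ y, π y * g y = g x := by
      rw [Finset.sum_congr rfl fun y _ => by rw [hc y x], ← Finset.sum_mul,
        h.stationary.sum_eq_one, one_mul]
    rw [← h2, h0]; rfl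
  obtain ⟨g, hg⟩ := (LinearMap.injective_iff_surjective.1 hinj) f
  refine ⟨g, fun x => ?_⟩
  have h0 : ∑ y, π y * g y = 0 := by rw [← hmean g, hg, hf]
  have := hT g x
  rw [hg, h0] at this
  linarith

/-- The weighted matrix `e^φ P` expands `ℓ²(π)` by at most `1 + O(τ² / ε)`, where `|φ| ≤ τ` and
`φ` has mean zero. Since the first-order term of the expansion in `φ` vanishes on constants, it
is absorbed by the contraction of `P` on mean-zero functions. -/
lemma ArmCondition.sum_sq_exp_mul_mulVec_le (h : ArmCondition P π r) {φ : S → ℝ} {τ : ℝ}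
    (hφ : ∑ x, π x * φ x = 0) (hτ : ∀ x, |φ x| ≤ τ) (hτε : τ ≤ eigenGap P π / 8) (g : S → ℝ) :
    ∑ z, π z * (Real.exp (φ z) * P.mulVec g z) ^ 2 ≤
      (1 + 10 * τ ^ 2 / eigenGap P π) * ∑ z, π z * g z ^ 2 := by
  set ε := eigenGap P π with hε
  have hε0 : 0 < ε := h.eigenGap_pos
  have hε1 : ε ≤ 1 := h.eigenGap_le_one
  have hπ := fun x => (h.pi_pos x).le
  have hsum := h.stationary.sum_eq_one
  obtain ⟨x0⟩ : Nonempty S := by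
    by_contra hne
    rw [not_nonempty_iff] at hne
    simp at hsum
  have hτ0 : 0 ≤ τ := (abs_nonneg _).trans (hτ x0)
  set a := ∑ x, π x * g x with ha
  set g0 : S → ℝ := fun x => g x - a with hg0
  set k : S → ℝ := P.mulVec g0 with hk
  have hg0mean : ∑ x, π x * g0 x = 0 := by
    simp_rw [hg0, mul_sub]
    rw [Finset.sum_sub_distrib, ← Finset.sum_mul, hsum, ← ha]; ring
  have hkmean : ∑ x, π x * k x = 0 := by rw [hk, h.sum_pi_mulVec, hg0mean]
  have hPg : ∀ z, P.mulVec g z = a + k z := by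
    intro z
    have : g = (fun _ => a) + g0 := by funext x; simp [hg0]
    conv_lhs => rw [this, Matrix.mulVec_add]
    simp only [Pi.add_apply, hk]
    congr 1
    simp [Matrix.mulVec, dotProduct, ← Finset.sum_mul, h.sum_row]
  have hsq : ∀ f : S → ℝ, ∑ x, π x * f x = 0 →
      ∑ x, π x * (a + f x) ^ 2 = a ^ 2 + ∑ x, π x * f x ^ 2 := by
    intro f hf
    have : ∀ x, π x * (a + f x) ^ 2 = π x * a ^ 2 + 2 * a * (π x * f x) + π x * f x ^ 2 :=
      fun x => by ring
    simp_rw [this]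
    rw [Finset.sum_add_distrib, Finset.sum_add_distrib, ← Finset.sum_mul, hsum, ← Finset.mul_sum,
      hf]
    ring
  set b2 := ∑ x, π x * k x ^ 2 with hb2
  set B2 := ∑ x, π x * g0 x ^ 2 with hB2
  have hb2nn : 0 ≤ b2 := Finset.sum_nonneg fun x _ => mul_nonneg (hπ x) (sq_nonneg _)
  have hB2nn : 0 ≤ B2 := Finset.sum_nonneg fun x _ => mul_nonneg (hπ x) (sq_nonneg _)
  have hgap : b2 ≤ (1 - ε) * B2 := h.sum_sq_mulVec_le_gap hg0mean
  have hgnorm : ∑ z, π z * g z ^ 2 = a ^ 2 + B2 := by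
    rw [← hsq g0 hg0mean]
    exact Finset.sum_congr rfl fun x _ => by simp [hg0]
  -- pointwise expansion of `exp (2 φ)`
  have hexp : ∀ x, Real.exp (φ x) ^ 2 ≤ 1 + 2 * φ x + 4 * τ ^ 2 := by
    intro x
    have h1 := hτ x
    have h2 : |2 * φ x| ≤ 1 := by rw [abs_mul]; norm_num; linarith
    have h3 := (abs_le.1 (Real.abs_exp_sub_one_sub_id_le h2)).2
    have h4 : φ x ^ 2 ≤ τ ^ 2 := sq_le_sq' (abs_le.1 h1).1 (abs_le.1 h1).2
    have h5 : Real.exp (φ x) ^ 2 = Real.exp (2 * φ x) := by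
      rw [← Real.exp_nat_mul]; norm_num
    rw [h5]
    nlinarith
  -- Young's inequality for the cross term `4 a φ k`
  have hcross : ∀ x, 2 * φ x * (a + k x) ^ 2 ≤
      2 * φ x * a ^ 2 + 16 / 3 * τ ^ 2 / ε * a ^ 2 + ε * k x ^ 2 := by
    intro x
    have h1 := hτ x
    have h4 : φ x ^ 2 ≤ τ ^ 2 := sq_le_sq' (abs_le.1 h1).1 (abs_le.1 h1).2
    have h6 : 2 * φ x * k x ^ 2 ≤ ε / 4 * k x ^ 2 := by
      apply mul_le_mul_of_nonneg_right _ (sq_nonneg _)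
      have := (abs_le.1 h1).2; linarith
    have h7 : 4 * φ x * a * k x ≤ 16 / 3 * φ x ^ 2 / ε * a ^ 2 + 3 / 4 * ε * k x ^ 2 := by
      have h8 : 16 / 3 * φ x ^ 2 / ε * a ^ 2 + 3 / 4 * ε * k x ^ 2 - 4 * φ x * a * k x
          = (16 * φ x * a - 6 * ε * k x) ^ 2 / (48 * ε) := by
        field_simp; ring
      have h9 : 0 ≤ (16 * φ x * a - 6 * ε * k x) ^ 2 / (48 * ε) := by positivity
      linarith
    have h10 : 16 / 3 * φ x ^ 2 / ε * a ^ 2 ≤ 16 / 3 * τ ^ 2 / ε * a ^ 2 := by gcongr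
    nlinarith
  have hpt : ∀ x, π x * (Real.exp (φ x) * P.mulVec g x) ^ 2 ≤
      (1 + 4 * τ ^ 2) * (π x * (a + k x) ^ 2) + 2 * a ^ 2 * (π x * φ x)
        + 16 / 3 * τ ^ 2 / ε * a ^ 2 * π x + ε * (π x * k x ^ 2) := by
    intro x
    have h1 : (Real.exp (φ x) * P.mulVec g x) ^ 2 ≤ (1 + 4 * τ ^ 2) * (a + k x) ^ 2 +
        (2 * φ x * a ^ 2 + 16 / 3 * τ ^ 2 / ε * a ^ 2 + ε * k x ^ 2) := by
      rw [hPg, mul_pow]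
      have := mul_le_mul_of_nonneg_right (hexp x) (sq_nonneg (a + k x))
      linarith [hcross x]
    have := mul_le_mul_of_nonneg_left h1 (hπ x)
    linarith
  refine (Finset.sum_le_sum fun x _ => hpt x).trans ?_
  rw [Finset.sum_add_distrib, Finset.sum_add_distrib, Finset.sum_add_distrib, ← Finset.mul_sum,
    ← Finset.mul_sum, ← Finset.mul_sum, ← Finset.mul_sum, hsq k hkmean, hφ, hsum, hgnorm, ← hb2]
  have h1 : 4 * τ ^ 2 ≤ 4 * τ ^ 2 / ε := by
    rw [le_div_iff₀ hε0]; nlinarith [sq_nonneg τ]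
  have h2 : 10 * τ ^ 2 / ε = 2 / 3 * (τ ^ 2 / ε) + 4 * τ ^ 2 / ε + 16 / 3 * τ ^ 2 / ε := by ring
  have h3 : 0 ≤ τ ^ 2 / ε := by positivity
  have h4 : (1 + 4 * τ ^ 2 + ε) * b2 ≤ (1 + 4 * τ ^ 2) * B2 := by
    have h5 : (1 + 4 * τ ^ 2 + ε) * b2 ≤ (1 + 4 * τ ^ 2 + ε) * ((1 - ε) * B2) := by gcongr
    have h6 : (1 + 4 * τ ^ 2 + ε) * (1 - ε) ≤ 1 + 4 * τ ^ 2 := by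
      nlinarith [mul_nonneg (sq_nonneg τ) hε0.le, sq_nonneg ε]
    nlinarith [mul_le_mul_of_nonneg_right h6 hB2nn]
  have h7 : (1 + 4 * τ ^ 2) * B2 ≤ (1 + 10 * τ ^ 2 / ε) * B2 := by
    gcongr
    have : 16 / 3 * τ ^ 2 / ε = 16 / 3 * (τ ^ 2 / ε) := by ring
    linarith
  have h8 : (1 + 4 * τ ^ 2 + 16 / 3 * τ ^ 2 / ε) * a ^ 2 ≤ (1 + 10 * τ ^ 2 / ε) * a ^ 2 :=
    mul_le_mul_of_nonneg_right (by linarith) (sq_nonneg a)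
  linarith

end Gap

/-! ### Expectations along a Markov chain and the Chernoff bound -/

section ChainBounds

variable {S : Type*} [Fintype S] [DecidableEq S] [MeasurableSpace S] [DiscreteMeasurableSpace S]
  {Ω : Type*} [MeasurableSpace Ω] {Pr : Measure Ω} [IsProbabilityMeasure Pr]
  {P : Matrix S S ℝ} {π r : S → ℝ} {X : ℕ → Ω → S}

omit [Fintype S] [DecidableEq S] [DiscreteMeasurableSpace S] [IsProbabilityMeasure Pr] in
lemma IsMarkovChain.real_prefix (hX : IsMarkovChain P X Pr) {m : ℕ} (w : Fin (m + 1) → S) (y : S) :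
    Pr.real {ω | (∀ k : Fin (m + 1), X k ω = w k) ∧ X (m + 1) ω = y} =
      Pr.real {ω | ∀ k : Fin (m + 1), X k ω = w k} * P (w (Fin.last m)) y := by
  let x : ℕ → S := fun k => if hk : k < m + 1 then w ⟨k, hk⟩ else y
  have hx : ∀ k : Fin (m + 1), x k = w k := fun k => dif_pos k.2
  have hy : x (m + 1) = y := by simp [x]
  have hl : x m = w (Fin.last m) := hx (Fin.last m)
  have h := hX.markov m x
  have e1 : {ω | ∀ k ≤ m, X k ω = x k} = {ω | ∀ k : Fin (m + 1), X k ω = w k} := by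
    ext ω
    exact ⟨fun h k => (h k (Nat.lt_succ_iff.1 k.2)).trans (hx k),
      fun h k hk => (h ⟨k, Nat.lt_succ_iff.2 hk⟩).trans (hx ⟨k, Nat.lt_succ_iff.2 hk⟩).symm⟩
  have e2 : {ω | ∀ k ≤ m + 1, X k ω = x k} =
      {ω | (∀ k : Fin (m + 1), X k ω = w k) ∧ X (m + 1) ω = y} := by
    ext ω
    constructor
    · exact fun h => ⟨fun k => (h k (by have := k.2; omega)).trans (hx k), (h _ le_rfl).trans hy⟩
    · rintro ⟨h1, h2⟩ k hk
      rcases hk.lt_or_eq with hk | rfl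
      · exact (h1 ⟨k, hk⟩).trans (hx ⟨k, hk⟩).symm
      · exact h2.trans hy.symm
  rw [e1, e2, hl, hy] at h
  exact h

/-- The Markov property as an identity of expectations: `g (X_{m+1})` may be replaced by
`(P g) (X_m)` against any weight that depends on `X_0, …, X_m` and on randomness independent of
the chain. -/
lemma IsMarkovChain.integral_mul_succ (hX : IsMarkovChain P X Pr) {m : ℕ}
    (Φ : (Fin (m + 1) → S) → Ω → ℝ) (hint : ∀ w, Integrable (Φ w) Pr)
    (hind : ∀ w, IndepFun (Φ w) (fun ω s => X s ω) Pr) (g : S → ℝ) :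
    ∫ ω, Φ (fun k => X k ω) ω * g (X (m + 1) ω) ∂Pr =
      ∫ ω, Φ (fun k => X k ω) ω * P.mulVec g (X m ω) ∂Pr := by
  have hXm := hX.measurable
  let A : (Fin (m + 1) → S) → Set (ℕ → S) := fun w => {x | ∀ k : Fin (m + 1), x k = w k}
  have hA : ∀ w, MeasurableSet (A w) := fun w => by
    have : A w = ⋂ k : Fin (m + 1), (fun x : ℕ → S => x k) ⁻¹' {w k} := by ext; simp [A]
    rw [this]
    exact MeasurableSet.iInter fun k => measurable_pi_apply _ (measurableSet_singleton _)
  -- decomposition along the prefix of the path, for a function `f` of the state at time `j`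
  have key : ∀ (f : S → ℝ) (j : ℕ), ∫ ω, Φ (fun k => X k ω) ω * f (X j ω) ∂Pr =
      ∑ w, (∫ ω, Φ w ω ∂Pr) * ∑ y, f y *
        Pr.real {ω | (∀ k : Fin (m + 1), X k ω = w k) ∧ X j ω = y} := by
    intro f j
    let F : (Fin (m + 1) → S) → (ℕ → S) → ℝ := fun w => (A w).indicator fun x => f (x j)
    have hF : ∀ w, Measurable (F w) := fun w =>
      ((measurable_of_finite f).comp (measurable_pi_apply j)).indicator (hA w)
    have hpath : Measurable fun ω s => X s ω := measurable_pi_lambda _ hXm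
    obtain ⟨c, hc⟩ : ∃ c, ∀ y, |f y| ≤ c := by
      obtain ⟨c, hc⟩ := (Set.finite_range fun y => |f y|).bddAbove
      exact ⟨c, fun y => hc ⟨y, rfl⟩⟩
    have hFi : ∀ w, Integrable (fun ω => F w fun s => X s ω) Pr := fun w => by
      refine Integrable.of_bound (C := c) ((hF w).comp hpath).aestronglyMeasurable
        (Filter.Eventually.of_forall fun ω => ?_)
      simp only [F, Set.indicator, Real.norm_eq_abs]
      split_ifs
      · exact hc _
      · simpa using (abs_nonneg _).trans (hc (X 0 ω))
    have hI : ∀ w, IndepFun (Φ w) (fun ω => F w fun s => X s ω) Pr := fun w =>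
      (hind w).comp measurable_id (hF w)
    have e1 : ∀ ω, Φ (fun k => X k ω) ω * f (X j ω) = ∑ w, Φ w ω * F w (fun s => X s ω) := by
      intro ω
      rw [Finset.sum_eq_single (fun k : Fin (m + 1) => X k ω)]
      · rw [show F (fun k : Fin (m + 1) => X k ω) (fun s => X s ω) = f (X j ω) from
          Set.indicator_of_mem (by simp [A]) _]
      · intro w _ hw
        rw [show F w (fun s => X s ω) = 0 from
          Set.indicator_of_notMem (fun h => hw (funext fun k => (h k).symm)) _, mul_zero]
      · simp
    simp_rw [e1]
    have hprod : ∀ w, Integrable (fun ω => Φ w ω * F w fun s => X s ω) Pr := fun w =>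
      (hI w).integrable_mul (hint w) (hFi w)
    rw [integral_finsetSum _ fun w _ => hprod w]
    refine Finset.sum_congr rfl fun w _ => ?_
    rw [(hI w).integral_fun_mul_eq_mul_integral (hint w).aestronglyMeasurable
      (hFi w).aestronglyMeasurable]
    congr 1
    have hms : ∀ y, MeasurableSet {ω | (∀ k : Fin (m + 1), X k ω = w k) ∧ X j ω = y} := fun y =>
      (hpath (hA w)).inter (hXm j (measurableSet_singleton y))
    have e2 : ∀ ω, F w (fun s => X s ω) = ∑ y, f y *
        ({ω | (∀ k : Fin (m + 1), X k ω = w k) ∧ X j ω = y}.indicator (fun _ => (1 : ℝ)) ω) := by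
      intro ω
      rw [Finset.sum_eq_single (X j ω)]
      · simp only [F, A, Set.indicator, Set.mem_ofPred_eq, and_true]
        split_ifs <;> simp
      · intro y _ hy
        rw [Set.indicator_of_notMem (fun h => hy h.2.symm), mul_zero]
      · simp
    simp_rw [e2]
    rw [integral_finsetSum _ fun y _ => ((integrable_const _).indicator (hms y)).const_mul _]
    refine Finset.sum_congr rfl fun y _ => ?_
    rw [integral_const_mul, integral_indicator_const _ (hms y)]
    simp
  rw [key g (m + 1), key (P.mulVec g) m]
  refine Finset.sum_congr rfl fun w _ => ?_
  congr 1
  simp_rw [hX.real_prefix]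
  symm
  rw [Finset.sum_eq_single (w (Fin.last m))]
  · have : {ω | (∀ k : Fin (m + 1), X k ω = w k) ∧ X m ω = w (Fin.last m)} =
        {ω | ∀ k : Fin (m + 1), X k ω = w k} := by
      ext ω; exact and_iff_left_of_imp fun h => h (Fin.last m)
    rw [this, Matrix.mulVec, dotProduct, Finset.sum_mul]
    exact Finset.sum_congr rfl fun y _ => by ring
  · intro y _ hy
    have : {ω | (∀ k : Fin (m + 1), X k ω = w k) ∧ X m ω = y} = ∅ := by
      ext ω
      simp only [Set.mem_ofPred_eq, Set.mem_empty_iff_false, iff_false, not_and]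
      exact fun h h' => hy (h'.symm.trans (h (Fin.last m)))
    rw [this]; simp
  · simp

/-- The Feynman–Kac formula for the exponential moments of an additive functional. -/
lemma IsMarkovChain.integral_exp_sum_mul (hX : IsMarkovChain P X Pr) (φ : S → ℝ) (m : ℕ)
    (g : S → ℝ) :
    ∫ ω, Real.exp (∑ s ∈ Finset.range m, φ (X s ω)) * g (X m ω) ∂Pr =
      ∫ ω, ((fun (v : S → ℝ) x => Real.exp (φ x) * P.mulVec v x)^[m] g) (X 0 ω) ∂Pr := by
  induction m generalizing g with
  | zero => simp
  | succ m ih =>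
    rw [Function.iterate_succ_apply, ← ih]
    have := hX.integral_mul_succ (m := m)
      (fun w _ => Real.exp (∑ k : Fin (m + 1), φ (w k)))
      (fun w => integrable_const _) (fun w => (indepFun_const_left _ _)) g
    simp_rw [Finset.sum_range]
    rw [this]
    refine integral_congr_ae (Filter.Eventually.of_forall fun ω => ?_)
    simp only [Fin.sum_univ_castSucc, Real.exp_add, Fin.val_castSucc, Fin.val_last]
    ring

lemma ArmCondition.mgf_sum_le (h : ArmCondition P π r) (hX : IsMarkovChain P X Pr)
    {φ : S → ℝ} {τ δ : ℝ} (hφ : ∑ x, π x * φ x = 0) (hτ : ∀ x, |φ x| ≤ τ)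
    (hτε : τ ≤ eigenGap P π / 8) (hδ : 0 < δ) (hδπ : ∀ x, δ ≤ π x) (m : ℕ) :
    ∫ ω, Real.exp (∑ s ∈ Finset.range m, φ (X s ω)) ∂Pr ≤
      δ⁻¹ * Real.exp (5 * m * τ ^ 2 / eigenGap P π) := by
  set T := fun (v : S → ℝ) x => Real.exp (φ x) * P.mulVec v x with hT
  have hiter : ∀ m : ℕ, ∑ z, π z * (T^[m] (fun _ => 1)) z ^ 2 ≤
      Real.exp (10 * τ ^ 2 / eigenGap P π) ^ m := by
    intro m
    induction m with
    | zero => simp [h.stationary.sum_eq_one]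
    | succ m ih =>
      rw [Function.iterate_succ_apply', pow_succ', hT]
      refine (h.sum_sq_exp_mul_mulVec_le hφ hτ hτε _).trans ?_
      have h0 : 0 ≤ ∑ z, π z * (T^[m] (fun _ => 1)) z ^ 2 :=
        Finset.sum_nonneg fun z _ => mul_nonneg (h.pi_pos z).le (sq_nonneg _)
      refine mul_le_mul ?_ ih h0 (Real.exp_pos _).le
      linarith [Real.add_one_le_exp (10 * τ ^ 2 / eigenGap P π)]
  have hpt : ∀ x, (T^[m] (fun _ => 1)) x ≤ δ⁻¹ * Real.exp (5 * m * τ ^ 2 / eigenGap P π) := by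
    intro x
    have hδ1 : δ ≤ 1 := by
      refine (hδπ x).trans ?_
      rw [← h.stationary.sum_eq_one]
      exact Finset.single_le_sum (f := π) (fun z _ => (h.pi_pos z).le) (Finset.mem_univ x)
    refine le_of_sq_le_sq ?_ (by positivity)
    have h1 : δ * (T^[m] (fun _ => 1)) x ^ 2 ≤ Real.exp (10 * τ ^ 2 / eigenGap P π) ^ m :=
      calc _ ≤ π x * (T^[m] (fun _ => 1)) x ^ 2 := by gcongr; exact hδπ x
        _ ≤ ∑ z, π z * (T^[m] (fun _ => 1)) z ^ 2 :=
          Finset.single_le_sum (f := fun z => π z * (T^[m] (fun _ => 1)) z ^ 2)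
            (fun z _ => mul_nonneg (h.pi_pos z).le (sq_nonneg _)) (Finset.mem_univ x)
        _ ≤ _ := hiter m
    have h2 : Real.exp (10 * τ ^ 2 / eigenGap P π) ^ m
        = Real.exp (5 * m * τ ^ 2 / eigenGap P π) ^ 2 := by
      rw [← Real.exp_nat_mul, ← Real.exp_nat_mul]; congr 1; push_cast; ring
    rw [h2] at h1
    have h3 : (T^[m] (fun _ => 1)) x ^ 2 ≤
        δ⁻¹ * Real.exp (5 * m * τ ^ 2 / eigenGap P π) ^ 2 := by
      rw [inv_mul_eq_div, le_div_iff₀ hδ]; linarith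
    refine h3.trans ?_
    rw [mul_pow]
    gcongr
    have := one_le_inv₀ hδ |>.2 hδ1
    nlinarith
  have hFK := hX.integral_exp_sum_mul φ m (fun _ => 1)
  simp only [mul_one] at hFK
  rw [hFK]
  have hmeas := hX.measurable 0
  have hi : Integrable (fun ω => (T^[m] (fun _ => 1)) (X 0 ω)) Pr := by
    obtain ⟨c, hc⟩ := (Set.finite_range fun y => ‖(T^[m] (fun _ => 1)) y‖).bddAbove
    exact Integrable.of_bound (C := c)
      ((measurable_of_finite _).comp hmeas).aestronglyMeasurable
      (Filter.Eventually.of_forall fun ω => hc ⟨X 0 ω, rfl⟩)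
  calc _ ≤ ∫ _, δ⁻¹ * Real.exp (5 * m * τ ^ 2 / eigenGap P π) ∂Pr :=
        integral_mono hi (integrable_const _) fun ω => hpt _
    _ = _ := by simp

/-- A Chernoff bound for additive functionals of a Markov chain that need not be reversible, with
the spectral gap of the multiplicative symmetrization. -/
lemma ArmCondition.real_sum_ge_le (h : ArmCondition P π r) (hX : IsMarkovChain P X Pr)
    {f : S → ℝ} {R δ γ : ℝ} (hf : ∑ x, π x * f x = 0) (hR : 0 < R) (hfR : ∀ x, |f x| ≤ R)
    (hδ : 0 < δ) (hδπ : ∀ x, δ ≤ π x) (hγ : 0 ≤ γ) (m : ℕ) :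
    Pr.real {ω | m * γ ≤ ∑ s ∈ Finset.range m, f (X s ω)} ≤
      δ⁻¹ * Real.exp (-(3 / 64 * (m * γ ^ 2) * eigenGap P π / R ^ 2)) := by
  have hε0 := h.eigenGap_pos
  set ε := eigenGap P π with hε
  rcases Nat.eq_zero_or_pos m with rfl | hm
  · obtain ⟨ω0⟩ : Nonempty Ω := nonempty_of_isProbabilityMeasure Pr
    have hδ1 : δ ≤ 1 := by
      refine (hδπ (X 0 ω0)).trans ?_
      rw [← h.stationary.sum_eq_one]
      exact Finset.single_le_sum (f := π) (fun z _ => (h.pi_pos z).le) (Finset.mem_univ _)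
    have := one_le_inv₀ hδ |>.2 hδ1
    refine measureReal_le_one.trans ?_
    simpa using this
  have hm' : (0 : ℝ) < m := by exact_mod_cast hm
  rcases le_or_gt γ R with hγR | hγR
  · -- near-optimal tilt `θ`; the range `γ ≤ R` is what keeps `τ = θ R` below `ε / 8`
    set τ := γ * ε / (8 * R) with hτ
    set θ := γ * ε / (8 * R ^ 2) with hθ
    have hθ0 : 0 ≤ θ := by positivity
    have hmgf := h.mgf_sum_le hX (φ := fun x => θ * f x) (τ := τ) (δ := δ)
      (by
        have : ∀ x, π x * (θ * f x) = θ * (π x * f x) := fun x => by ring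
        simp_rw [this, ← Finset.mul_sum, hf, mul_zero])
      (fun x => by
        rw [abs_mul, abs_of_nonneg hθ0]
        calc θ * |f x| ≤ θ * R := by gcongr; exact hfR x
          _ = τ := by rw [hθ, hτ]; field_simp)
      (by
        rw [hτ, div_le_div_iff₀ (by positivity) (by norm_num)]
        nlinarith) hδ hδπ m
    have hint : Integrable (fun ω => Real.exp (θ * ∑ s ∈ Finset.range m, f (X s ω))) Pr := by
      refine Integrable.of_bound (C := Real.exp (θ * (m * R))) ?_
        (Filter.Eventually.of_forall fun ω => ?_)
      · have hXm := hX.measurable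
        have : ∀ s, Measurable fun ω => f (X s ω) := fun s =>
          (measurable_of_finite f).comp (hXm s)
        exact (Real.measurable_exp.comp
          ((Finset.measurable_sum _ fun s _ => this s).const_mul θ)).aestronglyMeasurable
      · rw [Real.norm_eq_abs, Real.abs_exp]
        gcongr
        calc _ ≤ ∑ s ∈ Finset.range m, R := Finset.sum_le_sum fun s _ => (abs_le.1 (hfR _)).2
          _ = m * R := by simp
    refine (measure_ge_le_exp_mul_mgf (m * γ) hθ0 hint).trans ?_
    have hmgf' : mgf (fun ω => ∑ s ∈ Finset.range m, f (X s ω)) Pr θ ≤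
        δ⁻¹ * Real.exp (5 * m * τ ^ 2 / ε) := by
      refine le_of_eq_of_le ?_ hmgf
      simp only [mgf, Finset.mul_sum]
    calc _ ≤ Real.exp (-θ * (m * γ)) * (δ⁻¹ * Real.exp (5 * m * τ ^ 2 / ε)) := by gcongr
      _ = δ⁻¹ * Real.exp (-θ * (m * γ) + 5 * m * τ ^ 2 / ε) := by rw [Real.exp_add]; ring
      _ = _ := by
        congr 2
        rw [hθ, hτ]
        field_simp
        ring
  · -- a mean of terms bounded by `R` cannot reach `γ > R`
    have : {ω | m * γ ≤ ∑ s ∈ Finset.range m, f (X s ω)} = ∅ := by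
      ext ω
      simp only [Set.mem_ofPred_eq, Set.mem_empty_iff_false, iff_false, not_le]
      calc _ ≤ ∑ s ∈ Finset.range m, R := Finset.sum_le_sum fun s _ => (abs_le.1 (hfR _)).2
        _ = m * R := by simp
        _ < m * γ := by gcongr
    rw [this]
    simp only [measureReal_empty]
    positivity

end ChainBounds

/-! ### Play counts and histories of a policy -/

section Paths

variable {K : ℕ} {S : Fin K → Type*} {Ξ : Type*} [MeasurableSpace Ξ]
  (α : Policy S Ξ) (u : Ξ) (x : ∀ i, ℕ → S i)

lemma plays_zero (i : Fin K) : plays α u x 0 i = 0 := rfl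

lemma plays_succ (t : ℕ) (i : Fin K) :
    plays α u x (t + 1) i = plays α u x t i + if i ∈ played α u x t then 1 else 0 := by
  simp only [plays, numPlays, history, played, List.countP_cons]
  split_ifs <;> simp_all

lemma plays_le (t : ℕ) (i : Fin K) : plays α u x t i ≤ t := by
  induction t with
  | zero => simp [plays_zero]
  | succ t ih => rw [plays_succ]; split_ifs <;> omega

lemma plays_mono (i : Fin K) : Monotone fun t => plays α u x t i :=
  monotone_nat_of_le_succ fun t => by rw [plays_succ]; omega

lemma sum_plays {M : ℕ} (hcard : ∀ t, (played α u x t).card = M) (t : ℕ) :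
    ∑ i, plays α u x t i = t * M := by
  induction t with
  | zero => simp [plays_zero]
  | succ t ih =>
    simp_rw [plays_succ]
    rw [Finset.sum_add_distrib, ih, Finset.sum_boole, Finset.filter_mem_eq_inter,
      Finset.univ_inter, hcard]
    push_cast; ring

/-- The history after `t` slots depends only on the states met in these slots. -/
lemma history_congr {x' : ∀ i, ℕ → S i} {t : ℕ}
    (h : ∀ j, ∀ k < plays α u x t j, x j k = x' j k) :
    history α u x t = history α u x' t := by
  induction t with
  | zero => rfl
  | succ t ih =>
    have ih' := ih fun j k hk => h j k (hk.trans_le (plays_mono α u x j t.le_succ))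
    simp only [history]
    rw [← ih']
    congr 1
    funext i
    split_ifs with hi
    · have := h i (plays α u x t i) (by rw [plays_succ, if_pos (by exact hi)]; omega)
      exact congrArg some this
    · rfl

/-- The event that arm `i` is played for the `(s+1)`-st time in slot `t + 1` is determined by the
first `s` states of that arm and by the other arms. -/
lemma mem_played_and_plays_eq_congr {x' : ∀ i, ℕ → S i} {t s : ℕ} {i : Fin K}
    (hne : ∀ j ≠ i, x j = x' j) (hi : ∀ k < s, x i k = x' i k) :
    (i ∈ played α u x t ∧ plays α u x t i = s) ↔
      (i ∈ played α u x' t ∧ plays α u x' t i = s) := by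
  have key : ∀ y y' : ∀ i, ℕ → S i, (∀ j ≠ i, y j = y' j) → (∀ k < s, y i k = y' i k) →
      (i ∈ played α u y t ∧ plays α u y t i = s) →
      (i ∈ played α u y' t ∧ plays α u y' t i = s) := by
    rintro y y' h1 h2 ⟨h3, h4⟩
    have : history α u y t = history α u y' t := by
      refine history_congr α u y fun j k hk => ?_
      by_cases hj : j = i
      · subst hj; exact h2 k (h4 ▸ hk)
      · rw [h1 j hj]
    simp only [played, plays] at *
    rw [← this]
    exact ⟨h3, h4⟩
  exact ⟨key x x' hne hi, key x' x (fun j hj => (hne j hj).symm) fun k hk => (hi k hk).symm⟩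

/-- The total reward, rewritten with solutions `h i` of the Poisson equations
`r i - μ i = h i - q i`, `q i = P i (h i)`: up to a bounded term and to a sum of martingale
increments, every play of arm `i` yields `μ i`. -/
lemma totalReward_eq_of_poisson (r h q : ∀ i, S i → ℝ) (μ : Fin K → ℝ)
    (hp : ∀ i y, r i y - μ i = h i y - q i y) (n : ℕ) :
    totalReward α r u x n = ∑ i, (μ i * plays α u x n i + h i (x i 0) -
      h i (x i (plays α u x n i)) + ∑ t ∈ Finset.range n, if i ∈ played α u x t then
        h i (x i (plays α u x t i + 1)) - q i (x i (plays α u x t i)) else 0) := by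
  have e : totalReward α r u x n = ∑ i, ∑ t ∈ Finset.range n,
      if i ∈ played α u x t then r i (x i (plays α u x t i)) else 0 := by
    rw [totalReward, Finset.sum_comm]
    exact Finset.sum_congr rfl fun t _ => by simp [Finset.sum_ite_mem]
  rw [e]
  clear e
  refine Finset.sum_congr rfl fun i _ => ?_
  induction n with
  | zero => simp [plays_zero]
  | succ n ih =>
    rw [Finset.sum_range_succ, Finset.sum_range_succ, ih, plays_succ]
    split_ifs
    · push_cast
      linarith [hp i (x i (plays α u x n i))]
    · simp

/-- Playing `M` arms per slot loses, against always playing the first `M` arms, at most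
`μ₀ - μ i` per play of an arm `i ≥ M`. -/
lemma mul_sum_sub_sum_plays_le {M : ℕ} (hcard : ∀ t, (played α u x t).card = M)
    {μ : Fin K → ℝ} {μ0 : ℝ} (hμ : ∀ i, μ i ≤ μ0) (hMK : M ≤ K) (n : ℕ) :
    n * ∑ j : Fin K with j.val < M, μ j - ∑ i, μ i * plays α u x n i ≤
      ∑ i : Fin K with M ≤ i.val, (μ0 - μ i) * plays α u x n i := by
  have hs := sum_plays α u x hcard n
  have hs' : ∑ i, (plays α u x n i : ℝ) = n * M := by exact_mod_cast hs
  have hsplit : ∀ f : Fin K → ℝ, ∑ i, f i =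
      ∑ j : Fin K with j.val < M, f j + ∑ i : Fin K with M ≤ i.val, f i := fun f => by
    rw [← Finset.sum_filter_add_sum_filter_not Finset.univ (fun j : Fin K => j.val < M)]
    simp only [not_lt]
  have hc : ∑ j : Fin K with j.val < M, (1 : ℝ) = M := by
    have : (Finset.univ.filter fun j : Fin K => j.val < M).card = M := by
      rw [Fin.card_filter_val_lt]; simp [hMK]
    simp [this]
  have h1 : ∑ j : Fin K with j.val < M, μ j * (n - plays α u x n j) ≤
      ∑ j : Fin K with j.val < M, μ0 * (n - plays α u x n j) := by
    refine Finset.sum_le_sum fun j _ => mul_le_mul_of_nonneg_right (hμ j) ?_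
    have : (plays α u x n j : ℝ) ≤ n := by exact_mod_cast plays_le α u x n j
    linarith
  simp_rw [mul_sub, sub_mul] at h1 ⊢
  rw [Finset.sum_sub_distrib, Finset.sum_sub_distrib, ← Finset.sum_mul, ← Finset.mul_sum,
    ← Finset.mul_sum] at h1
  rw [hsplit] at hs' ⊢
  rw [Finset.sum_sub_distrib, ← Finset.mul_sum]
  have h2 : ∑ j : Fin K with j.val < M, (n : ℝ) = n * M := by
    rw [← hc, Finset.mul_sum]; simp
  rw [h2] at h1
  have h3 := congrArg (μ0 * ·) hs'
  simp only [mul_add] at h3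
  linarith

end Paths

section Measurability

variable {K : ℕ} {S : Fin K → Type*} [∀ i, Finite (S i)] [∀ i, MeasurableSpace (S i)]
  [∀ i, DiscreteMeasurableSpace (S i)] {Ξ : Type*} [MeasurableSpace Ξ] (α : Policy S Ξ)

omit [∀ i, Finite (S i)] in
lemma measurableSet_history_eq (t : ℕ) (h : History S) :
    MeasurableSet {p : Ξ × ∀ i, ℕ → S i | history α p.1 p.2 t = h} := by
  induction t generalizing h with
  | zero => exact MeasurableSet.const (([] : History S) = h)
  | succ t ih =>
    match h with
    | [] =>
      simp [history]
    | o :: h' =>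
      have e : {p : Ξ × ∀ i, ℕ → S i | history α p.1 p.2 (t + 1) = o :: h'} =
          {p | history α p.1 p.2 t = h'} ∩ ⋃ B : Finset (Fin K),
            (Prod.fst ⁻¹' {v | α.select v h' = B} ∩ Prod.snd ⁻¹' ⋂ i,
              {x : ∀ i, ℕ → S i | (if i ∈ B then some (x i (numPlays h' i)) else none) = o i}) := by
        ext p
        simp only [history, List.cons.injEq, Set.mem_ofPred_eq, Set.mem_inter_iff, Set.mem_iUnion,
          Set.mem_preimage, Set.mem_iInter, exists_eq_left', funext_iff]
        constructor
        · rintro ⟨h1, h2⟩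
          rw [h2] at h1
          exact ⟨h2, h1⟩
        · rintro ⟨h2, h1⟩
          rw [h2]
          exact ⟨h1, rfl⟩
      rw [e]
      refine (ih h').inter (MeasurableSet.iUnion fun B => MeasurableSet.inter
        (measurable_fst (α.measurable_select h' B))
        (measurable_snd (MeasurableSet.iInter fun i => ?_)))
      have hm : Measurable fun x : ∀ i, ℕ → S i => x i (numPlays h' i) :=
        (measurable_pi_apply _).comp (measurable_pi_apply i)
      exact hm (t := {y | (if i ∈ B then some y else none) = o i})
        (MeasurableSet.of_discrete)

/-- A function of the history after `t` slots, the seed and the paths is measurable if it is so for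
every fixed history, as there are countably many histories. -/
lemma measurable_of_history {β : Type*} [MeasurableSpace β] (t : ℕ)
    {G : (Ξ × ∀ i, ℕ → S i) → History S → β} (hG : ∀ h, Measurable fun p => G p h) :
    Measurable fun p : Ξ × ∀ i, ℕ → S i => G p (history α p.1 p.2 t) := by
  intro B hB
  have e : (fun p : Ξ × ∀ i, ℕ → S i => G p (history α p.1 p.2 t)) ⁻¹' B =
      ⋃ h : History S, {p | history α p.1 p.2 t = h} ∩ (fun p => G p h) ⁻¹' B := by
    ext p; simp
  rw [e]
  exact MeasurableSet.iUnion fun h => (measurableSet_history_eq α t h).inter (hG h hB)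

lemma measurable_plays (t : ℕ) (i : Fin K) :
    Measurable fun p : Ξ × ∀ i, ℕ → S i => plays α p.1 p.2 t i :=
  measurable_of_history α t fun _ => measurable_const

omit [∀ i, Finite (S i)] [∀ i, DiscreteMeasurableSpace (S i)] in
lemma measurableSet_mem_select (h : History S) (i : Fin K) :
    MeasurableSet {p : Ξ × ∀ i, ℕ → S i | i ∈ α.select p.1 h} := by
  have e : {p : Ξ × ∀ i, ℕ → S i | i ∈ α.select p.1 h} =
      ⋃ B ∈ {B : Finset (Fin K) | i ∈ B}, Prod.fst ⁻¹' {v | α.select v h = B} := by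
    ext p; simp
  rw [e]
  exact MeasurableSet.biUnion (Set.to_countable _) fun B _ =>
    measurable_fst (α.measurable_select h B)

lemma measurableSet_mem_played (t : ℕ) (i : Fin K) :
    MeasurableSet {p : Ξ × ∀ i, ℕ → S i | i ∈ played α p.1 p.2 t} := by
  have : Measurable fun p : Ξ × ∀ i, ℕ → S i => i ∈ α.select p.1 (history α p.1 p.2 t) :=
    measurable_of_history α t (G := fun p h => i ∈ α.select p.1 h)
      fun h => measurableSet_setOfPred.1 (measurableSet_mem_select α h i)
  exact measurableSet_setOfPred.2 this

end Measurability

/-! ### Reduction of the regret to expected play counts -/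

section Regret

/-- If `Y` is independent of `(A, B)` and `A` of `B`, then `(Y, A)` is independent of `B`. -/
lemma indepFun_prodMk_left {Ω α β γ : Type*} [MeasurableSpace Ω] [MeasurableSpace α]
    [MeasurableSpace β] [MeasurableSpace γ] {Pr : Measure Ω} [IsProbabilityMeasure Pr]
    {Y : Ω → α} {A : Ω → β} {B : Ω → γ} (hY : Measurable Y) (hA : Measurable A)
    (hB : Measurable B) (h : IndepFun Y (fun ω => (A ω, B ω)) Pr) (hAB : IndepFun A B Pr) :
    IndepFun (fun ω => (Y ω, A ω)) B Pr := by
  have hYA : IndepFun Y A Pr := h.comp measurable_id measurable_fst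
  have := Measure.isProbabilityMeasure_map (μ := Pr) hY.aemeasurable
  have := Measure.isProbabilityMeasure_map (μ := Pr) hA.aemeasurable
  have := Measure.isProbabilityMeasure_map (μ := Pr) hB.aemeasurable
  rw [indepFun_iff_map_prod_eq_prod_map_map (by fun_prop) (by fun_prop)] at h hAB hYA ⊢
  rw [hAB] at h
  rw [hYA]
  apply MeasurableEquiv.prodAssoc.map_measurableEquiv_injective
  rw [Measure.prodAssoc_prod, ← h, Measure.map_map (MeasurableEquiv.measurable _) (by fun_prop)]
  rfl

variable {K : ℕ} {S : Fin K → Type*} [∀ i, Fintype (S i)] [∀ i, DecidableEq (S i)]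
  [∀ i, MeasurableSpace (S i)] [∀ i, DiscreteMeasurableSpace (S i)]
  {Ω : Type*} [MeasurableSpace Ω] {Pr : Measure Ω} [IsProbabilityMeasure Pr]
  {Ξ : Type*} [MeasurableSpace Ξ] {P : ∀ i, Matrix (S i) (S i) ℝ} {X : ∀ i, ℕ → Ω → S i}
  {ξ : Ω → Ξ}

omit [∀ i, DiscreteMeasurableSpace (S i)] [IsProbabilityMeasure Pr] in
lemma IsBanditModel.measurable_path (hm : IsBanditModel P X ξ Pr) (i : Fin K) :
    Measurable fun ω s => X i s ω := measurable_pi_lambda _ (hm.chain i).measurable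

omit [∀ i, DiscreteMeasurableSpace (S i)] [IsProbabilityMeasure Pr] in
lemma IsBanditModel.measurable_seed_paths (hm : IsBanditModel P X ξ Pr) :
    Measurable fun ω => ((ξ ω, fun i s => X i s ω) : Ξ × ∀ i, ℕ → S i) :=
  hm.measurable_seed.prodMk (measurable_pi_lambda _ fun i => hm.measurable_path i)

omit [∀ i, DiscreteMeasurableSpace (S i)] in
/-- The state path of an arm is independent of the seed together with all other arms. -/
lemma IsBanditModel.indepFun_others (hm : IsBanditModel P X ξ Pr) (i : Fin K) :
    IndepFun (fun ω => (ξ ω, fun (j : ({i}ᶜ : Finset (Fin K))) (s : ℕ) => X j s ω))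
      (fun ω s => X i s ω) Pr := by
  have hpath := hm.measurable_path
  have h1 := hm.indep_arms.indepFun_finset ({i}ᶜ) {i} disjoint_compl_left hpath
  have h2 : IndepFun (fun ω (j : ({i}ᶜ : Finset (Fin K))) (s : ℕ) => X j s ω)
      (fun ω s => X i s ω) Pr :=
    h1.comp measurable_id (ψ := fun y : ∀ j : ({i} : Finset (Fin K)), ℕ → S j =>
      y ⟨i, Finset.mem_singleton_self i⟩) (measurable_pi_apply _)
  refine indepFun_prodMk_left hm.measurable_seed (measurable_pi_lambda _ fun j => hpath j)
    (hpath i) ?_ h2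
  exact hm.indep_seed.comp measurable_id
    (ψ := fun x : ∀ i, ℕ → S i => (fun j : ({i}ᶜ : Finset (Fin K)) => x j, x i))
    (by fun_prop)

/-- The increments `h (X_{s+1}) - (P h) (X_s)` have mean zero on the event that arm `i` is played
for the `(s+1)`-st time in slot `t + 1`, since that event is determined by `X_0, …, X_s` and by
randomness independent of arm `i`. -/
lemma IsBanditModel.integral_increment_eq_zero (hm : IsBanditModel P X ξ Pr) (α : Policy S Ξ)
    (i : Fin K) (t s : ℕ) (h : S i → ℝ) :
    ∫ ω, ({p : Ξ × ∀ i, ℕ → S i | i ∈ played α p.1 p.2 t ∧ plays α p.1 p.2 t i = s}.indicator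
        (fun _ => (1 : ℝ)) (ξ ω, fun i s => X i s ω)) *
      (h (X i (s + 1) ω) - (P i).mulVec h (X i s ω)) ∂Pr = 0 := by
  set E := {p : Ξ × ∀ i, ℕ → S i | i ∈ played α p.1 p.2 t ∧ plays α p.1 p.2 t i = s} with hE
  have hEm : MeasurableSet E := (measurableSet_mem_played α t i).inter
    (measurable_plays α t i (measurableSet_singleton s))
  let ext : (Fin (s + 1) → S i) → ℕ → S i := fun w k => w ⟨min k s, by omega⟩
  -- the paths, with the path of arm `i` replaced by the extension of a fixed prefix `w`
  let H : (Fin (s + 1) → S i) → (Ξ × ∀ j : ({i}ᶜ : Finset (Fin K)), ℕ → S j) →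
      Ξ × ∀ j, ℕ → S j := fun w p =>
    (p.1, fun j => if hj : j = i then hj ▸ ext w else p.2 ⟨j, by simp [hj]⟩)
  have hH : ∀ w, Measurable (H w) := fun w => by
    refine measurable_fst.prodMk (measurable_pi_lambda _ fun j => ?_)
    by_cases hj : j = i
    · subst hj; simp
    · simp only [hj, dite_false]
      exact (measurable_pi_apply _).comp measurable_snd
  let Φ : (Fin (s + 1) → S i) → Ω → ℝ := fun w ω => E.indicator (fun _ => (1 : ℝ))
    (H w (ξ ω, fun j s => X j s ω))
  have hgm : ∀ w, Measurable fun p => E.indicator (fun _ => (1 : ℝ)) (H w p) := fun w =>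
    (measurable_const.indicator hEm).comp (hH w)
  have hind : ∀ w, IndepFun (Φ w) (fun ω s => X i s ω) Pr := fun w =>
    (hm.indepFun_others i).comp (hgm w) measurable_id
  have hoth : Measurable fun ω => ((ξ ω, fun j s => X j s ω) :
      Ξ × ∀ j : ({i}ᶜ : Finset (Fin K)), ℕ → S j) :=
    hm.measurable_seed.prodMk (measurable_pi_lambda _ fun j => hm.measurable_path j)
  have hint : ∀ w, Integrable (Φ w) Pr := fun w => by
    refine Integrable.of_bound (C := 1) ((hgm w).comp hoth).aestronglyMeasurable
      (Filter.Eventually.of_forall fun ω => ?_)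
    simp only [Φ, Set.indicator]
    split_ifs <;> simp
  have hΦ : ∀ ω, Φ (fun k => X i k ω) ω =
      E.indicator (fun _ => (1 : ℝ)) (ξ ω, fun i s => X i s ω) := fun ω => by
    have : H (fun k => X i k ω) (ξ ω, fun j s => X j s ω) ∈ E ↔
        ((ξ ω, fun i s => X i s ω) : Ξ × ∀ i, ℕ → S i) ∈ E := by
      refine mem_played_and_plays_eq_congr α (ξ ω) _ (fun j hj => ?_) fun k hk => ?_
      · simp [H, hj]
      · simp [H, ext, min_eq_left hk.le]
    simp only [Φ, Set.indicator]
    simp only [this]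
  have hX := (hm.chain i).measurable
  have hbd : ∀ (f : S i → ℝ) (k : ℕ), Integrable (fun ω =>
      E.indicator (fun _ => (1 : ℝ)) (ξ ω, fun i s => X i s ω) * f (X i k ω)) Pr := fun f k => by
    obtain ⟨c, hc⟩ := (Set.finite_range fun y => |f y|).bddAbove
    refine Integrable.of_bound (C := c) (Measurable.aestronglyMeasurable ?_)
      (Filter.Eventually.of_forall fun ω => ?_)
    · exact ((measurable_const.indicator hEm).comp hm.measurable_seed_paths).mul
        ((measurable_of_finite f).comp (hX k))
    · have h1 : |f (X i k ω)| ≤ c := hc ⟨_, rfl⟩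
      rw [norm_mul, Real.norm_eq_abs, Real.norm_eq_abs]
      simp only [Set.indicator]
      split_ifs
      · simpa using h1
      · simpa using (abs_nonneg _).trans h1
  simp_rw [mul_sub]
  rw [integral_sub (hbd _ _) (hbd _ _), sub_eq_zero]
  have := (hm.chain i).integral_mul_succ Φ hint hind h
  simp_rw [hΦ] at this
  exact this

omit [∀ i, DiscreteMeasurableSpace (S i)] in
lemma IsBanditModel.integrable_of_bound (hm : IsBanditModel P X ξ Pr)
    {f : (Ξ × ∀ i, ℕ → S i) → ℝ} (hf : Measurable f) (c : ℝ) (hc : ∀ p, |f p| ≤ c) :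
    Integrable (fun ω => f (ξ ω, fun i s => X i s ω)) Pr :=
  Integrable.of_bound (C := c) (hf.comp hm.measurable_seed_paths).aestronglyMeasurable
    (Filter.Eventually.of_forall fun _ => hc _)

lemma IsBanditModel.integrable_plays (hm : IsBanditModel P X ξ Pr) (α : Policy S Ξ) (n : ℕ)
    (i : Fin K) :
    Integrable (fun ω => (plays α (ξ ω) (fun i s => X i s ω) n i : ℝ)) Pr := by
  refine hm.integrable_of_bound (f := fun p => (plays α p.1 p.2 n i : ℝ))
    (measurable_from_top.comp (measurable_plays α n i)) n fun p => ?_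
  rw [abs_of_nonneg (Nat.cast_nonneg _)]
  exact_mod_cast plays_le α p.1 p.2 n i

omit [∀ i, DecidableEq (S i)] in
lemma measurable_state_at_plays (α : Policy S Ξ) (t a : ℕ) (i : Fin K) (f : S i → ℝ) :
    Measurable fun p : Ξ × ∀ i, ℕ → S i => f (p.2 i (plays α p.1 p.2 t i + a)) :=
  measurable_of_history α t (G := fun p h => f (p.2 i (numPlays h i + a))) fun _ =>
    (measurable_of_finite f).comp
      ((measurable_pi_apply _).comp ((measurable_pi_apply i).comp measurable_snd))

/-- Anantharam's regret decomposition: up to a constant independent of the policy and of the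
horizon, the regret is at most the expected number of plays of the suboptimal arms, weighted by
their distance to the best arm. The constant comes from solutions `h i` of the Poisson
equations. -/
lemma IsBanditModel.regret_le (hm : IsBanditModel P X ξ Pr) (α : Policy S Ξ)
    {π r h : ∀ i, S i → ℝ} {M : ℕ} (hMK : M ≤ K) (hcard : ∀ u x t, (played α u x t).card = M)
    (hp : ∀ i y, r i y - meanReward (π i) (r i) = h i y - (P i).mulVec (h i) y)
    {c : Fin K → ℝ} (hc : ∀ i y, |h i y| ≤ c i) {μ0 : ℝ}
    (hμ : ∀ i, meanReward (π i) (r i) ≤ μ0) (n : ℕ) :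
    regret α π r X ξ Pr M n ≤
      ∑ i : Fin K with M ≤ i.val, (μ0 - meanReward (π i) (r i)) *
        ∫ ω, (plays α (ξ ω) (fun i s => X i s ω) n i : ℝ) ∂Pr + ∑ i, 2 * c i := by
  set μ : Fin K → ℝ := fun i => meanReward (π i) (r i) with hμdef
  let D : Fin K → ℕ → (Ξ × ∀ i, ℕ → S i) → ℝ := fun i t p =>
    if i ∈ played α p.1 p.2 t then h i (p.2 i (plays α p.1 p.2 t i + 1)) -
      (P i).mulVec (h i) (p.2 i (plays α p.1 p.2 t i)) else 0
  -- the martingale increment of slot `t + 1`, split according to the number of earlier plays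
  have hDsum : ∀ i t p, D i t p = ∑ s ∈ Finset.range (t + 1),
      ({p : Ξ × ∀ i, ℕ → S i | i ∈ played α p.1 p.2 t ∧ plays α p.1 p.2 t i = s}.indicator
        (fun _ => (1 : ℝ)) p) * (h i (p.2 i (s + 1)) - (P i).mulVec (h i) (p.2 i s)) := by
    intro i t p
    rw [Finset.sum_eq_single (plays α p.1 p.2 t i)]
    · simp only [D, Set.indicator, Set.mem_ofPred_eq, and_true]
      split_ifs <;> simp
    · intro s _ hs
      rw [Set.indicator_of_notMem (fun h => hs h.2.symm), zero_mul]
    · intro hs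
      exact absurd (Finset.mem_range.2 (Nat.lt_succ_of_le (plays_le α p.1 p.2 t i))) hs
  have hinc : ∀ i t s, Integrable (fun ω =>
      ({p : Ξ × ∀ i, ℕ → S i | i ∈ played α p.1 p.2 t ∧ plays α p.1 p.2 t i = s}.indicator
        (fun _ => (1 : ℝ)) (ξ ω, fun i s => X i s ω)) *
          (h i (X i (s + 1) ω) - (P i).mulVec (h i) (X i s ω))) Pr := by
    intro i t s
    obtain ⟨c', hc'⟩ := (Set.finite_range fun y => |(P i).mulVec (h i) y|).bddAbove
    refine hm.integrable_of_bound (c := c i + c') (f := fun p =>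
      ({p : Ξ × ∀ i, ℕ → S i | i ∈ played α p.1 p.2 t ∧ plays α p.1 p.2 t i = s}.indicator
        (fun _ => (1 : ℝ)) p) * (h i (p.2 i (s + 1)) - (P i).mulVec (h i) (p.2 i s))) ?_ ?_
    · have hpt : ∀ k, Measurable fun p : Ξ × ∀ i, ℕ → S i => p.2 i k := fun k => by fun_prop
      exact (measurable_const.indicator ((measurableSet_mem_played α t i).inter
        (measurable_plays α t i (measurableSet_singleton s)))).mul
        (((measurable_of_finite (h i)).comp (hpt (s + 1))).sub
          ((measurable_of_finite ((P i).mulVec (h i))).comp (hpt s)))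
    · intro p
      have h1 : |h i (p.2 i (s + 1)) - (P i).mulVec (h i) (p.2 i s)| ≤ c i + c' :=
        (abs_sub _ _).trans (add_le_add (hc _ _) (hc' ⟨_, rfl⟩))
      rw [abs_mul]
      simp only [Set.indicator]
      split_ifs
      · simpa using h1
      · simpa using (abs_nonneg _).trans h1
  have hDint : ∀ i t, Integrable (fun ω => D i t (ξ ω, fun i s => X i s ω)) Pr := by
    intro i t
    simp_rw [hDsum]
    exact integrable_finsetSum _ fun s _ => hinc i t s
  have hDzero : ∀ i t, ∫ ω, D i t (ξ ω, fun i s => X i s ω) ∂Pr = 0 := by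
    intro i t
    simp_rw [hDsum]
    rw [integral_finsetSum _ fun s _ => hinc i t s]
    exact Finset.sum_eq_zero fun s _ => hm.integral_increment_eq_zero α i t s (h i)
  have hT := hm.integrable_plays α n
  -- pathwise comparison
  have hpath : ∀ ω, n * ∑ j : Fin K with j.val < M, μ j -
      ∑ i : Fin K with M ≤ i.val, (μ0 - μ i) * plays α (ξ ω) (fun i s => X i s ω) n i
        - ∑ i, 2 * c i + ∑ i, ∑ t ∈ Finset.range n, D i t (ξ ω, fun i s => X i s ω)
      ≤ totalReward α r (ξ ω) (fun i s => X i s ω) n := by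
    intro ω
    rw [totalReward_eq_of_poisson α (ξ ω) (fun i s => X i s ω) r h
      (fun i => (P i).mulVec (h i)) μ hp n, Finset.sum_add_distrib, Finset.sum_sub_distrib,
      Finset.sum_add_distrib]
    have h1 := mul_sum_sub_sum_plays_le α (ξ ω) (fun i s => X i s ω) (hcard _ _) hμ hMK n
    have h2 : ∑ i, h i (X i (plays α (ξ ω) (fun i s => X i s ω) n i) ω) - ∑ i, h i (X i 0 ω) ≤
        ∑ i, 2 * c i := by
      rw [← Finset.sum_sub_distrib]
      refine Finset.sum_le_sum fun i _ => ?_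
      have h3 := (abs_le.1 (hc i (X i (plays α (ξ ω) (fun i s => X i s ω) n i) ω))).2
      have h4 := (abs_le.1 (hc i (X i 0 ω))).1
      linarith
    simp only [D]
    linarith
  have hTi : ∀ i, Integrable (fun ω => (μ0 - μ i) *
      (plays α (ξ ω) (fun i s => X i s ω) n i : ℝ)) Pr := fun i => (hT i).const_mul _
  have hTs : Integrable (fun ω => ∑ i : Fin K with M ≤ i.val, (μ0 - μ i) *
      (plays α (ξ ω) (fun i s => X i s ω) n i : ℝ)) Pr :=
    integrable_finsetSum _ fun i _ => hTi i
  have hDs : Integrable (fun ω => ∑ i, ∑ t ∈ Finset.range n,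
      D i t (ξ ω, fun i s => X i s ω)) Pr :=
    integrable_finsetSum _ fun i _ => integrable_finsetSum _ fun t _ => hDint i t
  have hDs0 : ∫ ω, ∑ i, ∑ t ∈ Finset.range n, D i t (ξ ω, fun i s => X i s ω) ∂Pr = 0 := by
    rw [integral_finsetSum _ fun i _ => integrable_finsetSum _ fun t _ => hDint i t]
    refine Finset.sum_eq_zero fun i _ => ?_
    rw [integral_finsetSum _ fun t _ => hDint i t]
    exact Finset.sum_eq_zero fun t _ => hDzero i t
  have htot : Integrable (fun ω => totalReward α r (ξ ω) (fun i s => X i s ω) n) Pr := by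
    have e : ∀ ω, totalReward α r (ξ ω) (fun i s => X i s ω) n = ∑ i, (μ i *
        (plays α (ξ ω) (fun i s => X i s ω) n i : ℝ) + h i (X i 0 ω) -
        h i (X i (plays α (ξ ω) (fun i s => X i s ω) n i) ω) +
        ∑ t ∈ Finset.range n, D i t (ξ ω, fun i s => X i s ω)) := fun ω =>
      totalReward_eq_of_poisson α (ξ ω) (fun i s => X i s ω) r h
        (fun i => (P i).mulVec (h i)) μ hp n
    simp_rw [e]
    refine integrable_finsetSum _ fun i _ => Integrable.add (Integrable.sub (Integrable.add
      ((hT i).const_mul _) ?_) ?_) (integrable_finsetSum _ fun t _ => hDint i t)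
    · exact hm.integrable_of_bound (f := fun p => h i (p.2 i 0))
        ((measurable_of_finite (h i)).comp (by fun_prop)) (c i) fun p => hc _ _
    · exact hm.integrable_of_bound (f := fun p => h i (p.2 i (plays α p.1 p.2 n i)))
        (measurable_state_at_plays α n 0 i (h i)) (c i) fun p => hc _ _
  have hA1 : Integrable (fun ω => n * ∑ j : Fin K with j.val < M, μ j -
      ∑ i : Fin K with M ≤ i.val, (μ0 - μ i) *
        (plays α (ξ ω) (fun i s => X i s ω) n i : ℝ)) Pr := (integrable_const _).sub hTs
  have hA2 : Integrable (fun ω => n * ∑ j : Fin K with j.val < M, μ j -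
      ∑ i : Fin K with M ≤ i.val, (μ0 - μ i) *
        (plays α (ξ ω) (fun i s => X i s ω) n i : ℝ) - ∑ i, 2 * c i) Pr :=
    hA1.sub (integrable_const _)
  have hmono := integral_mono (hA2.add hDs) htot hpath
  have hcomp : ∫ ω, (n * ∑ j : Fin K with j.val < M, μ j -
      ∑ i : Fin K with M ≤ i.val, (μ0 - μ i) * plays α (ξ ω) (fun i s => X i s ω) n i
        - ∑ i, 2 * c i + ∑ i, ∑ t ∈ Finset.range n, D i t (ξ ω, fun i s => X i s ω)) ∂Pr =
      n * ∑ j : Fin K with j.val < M, μ j - ∑ i : Fin K with M ≤ i.val, (μ0 - μ i) *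
        ∫ ω, (plays α (ξ ω) (fun i s => X i s ω) n i : ℝ) ∂Pr - ∑ i, 2 * c i := by
    rw [integral_add hA2 hDs, integral_sub hA1 (integrable_const _),
      integral_sub (integrable_const _) hTs, integral_finsetSum _ fun i _ => hTi i, hDs0]
    simp [integral_const_mul]
  have hfin : n * ∑ j : Fin K with j.val < M, μ j - ∑ i : Fin K with M ≤ i.val, (μ0 - μ i) *
        ∫ ω, (plays α (ξ ω) (fun i s => X i s ω) n i : ℝ) ∂Pr - ∑ i, 2 * c i ≤
      ∫ ω, totalReward α r (ξ ω) (fun i s => X i s ω) n ∂Pr := hcomp ▸ hmono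
  rw [regret]
  linarith

end Regret

/-! ### Deviations of the sample means -/

section Deviation

variable {S : Type*} [Fintype S] [DecidableEq S] [MeasurableSpace S] [DiscreteMeasurableSpace S]
  {Ω : Type*} [MeasurableSpace Ω] {Pr : Measure Ω} [IsProbabilityMeasure Pr]
  {P : Matrix S S ℝ} {π r : S → ℝ} {X : ℕ → Ω → S}

omit [MeasurableSpace S] [DiscreteMeasurableSpace S] in
lemma ArmCondition.abs_sub_meanReward_le (h : ArmCondition P π r) {R : ℝ} (hR : ∀ x, r x ≤ R)
    (x : S) : |r x - meanReward π r| ≤ R := by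
  have h0 : 0 ≤ meanReward π r :=
    Finset.sum_nonneg fun y _ => mul_nonneg (h.reward_pos y).le (h.pi_pos y).le
  have h1 : meanReward π r ≤ R := by
    calc meanReward π r ≤ ∑ y, R * π y :=
          Finset.sum_le_sum fun y _ => mul_le_mul_of_nonneg_right (hR y) (h.pi_pos y).le
      _ = R := by rw [← Finset.mul_sum, h.stationary.sum_eq_one, mul_one]
  have h2 := h.reward_pos x
  have h3 := hR x
  exact abs_le.2 ⟨by linarith, by linarith⟩

/-- With the confidence radius `√(L ln t / s)`, the deviation bound becomes a multiple of `t⁻³`. -/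
lemma ArmCondition.real_sum_ge_radius_le (h : ArmCondition P π r) (hX : IsMarkovChain P X Pr)
    {f : S → ℝ} {R δ L : ℝ} (hf : ∑ x, π x * f x = 0) (hR : 0 < R) (hfR : ∀ x, |f x| ≤ R)
    (hδ : 0 < δ) (hδπ : ∀ x, δ ≤ π x) (hL : 64 * R ^ 2 ≤ L * eigenGap P π) {s t : ℕ} (hs : 1 ≤ s)
    (ht : 1 ≤ t) :
    Pr.real {ω | s * √(L * Real.log t / s) ≤ ∑ k ∈ Finset.range s, f (X k ω)} ≤
      δ⁻¹ * (1 / (t : ℝ) ^ 3) := by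
  refine (h.real_sum_ge_le hX hf hR hfR hδ hδπ (Real.sqrt_nonneg _) s).trans ?_
  gcongr
  have ht' : (0 : ℝ) < t := by exact_mod_cast ht
  have hs' : (0 : ℝ) < s := by exact_mod_cast hs
  have hlog : 0 ≤ Real.log t := Real.log_natCast_nonneg t
  have hL0 : 0 ≤ L := by
    have := h.eigenGap_pos
    by_contra hneg
    nlinarith [sq_nonneg R]
  have hsq : s * √(L * Real.log t / s) ^ 2 = L * Real.log t := by
    rw [Real.sq_sqrt (by positivity)]; field_simp
  rw [hsq]
  have e : 1 / (t : ℝ) ^ 3 = Real.exp (-(3 * Real.log t)) := by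
    rw [Real.exp_neg, one_div, ← Real.exp_log (pow_pos ht' 3), Real.log_pow]; norm_num
  rw [e, Real.exp_le_exp, neg_le_neg_iff, le_div_iff₀ (by positivity)]
  nlinarith [mul_le_mul_of_nonneg_left hL hlog]

lemma ArmCondition.real_mean_ge_le (h : ArmCondition P π r) (hX : IsMarkovChain P X Pr)
    {R δ L : ℝ} (hR : 0 < R) (hrR : ∀ x, r x ≤ R)
    (hδ : 0 < δ) (hδπ : ∀ x, δ ≤ π x) (hL : 64 * R ^ 2 ≤ L * eigenGap P π) {s t : ℕ} (hs : 1 ≤ s)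
    (ht : 1 ≤ t) :
    Pr.real {ω | meanReward π r + √(L * Real.log t / s) ≤
      (∑ k ∈ Finset.range s, r (X k ω)) / s} ≤ δ⁻¹ * (1 / (t : ℝ) ^ 3) := by
  have hs' : (0 : ℝ) < s := by exact_mod_cast hs
  refine le_trans (measureReal_mono fun ω hω => ?_) (h.real_sum_ge_radius_le hX
    (f := fun x => r x - meanReward π r) ?_ hR (h.abs_sub_meanReward_le hrR) hδ hδπ hL hs ht)
  · simp only [Set.mem_ofPred_eq, Finset.sum_sub_distrib, Finset.sum_const, Finset.card_range,
      nsmul_eq_mul] at hω ⊢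
    rw [le_div_iff₀ hs'] at hω
    linarith
  · simp_rw [mul_sub]
    rw [Finset.sum_sub_distrib, ← Finset.sum_mul, h.stationary.sum_eq_one, one_mul, meanReward,
      sub_eq_zero]
    exact Finset.sum_congr rfl fun x _ => mul_comm _ _

lemma ArmCondition.real_mean_le_le (h : ArmCondition P π r) (hX : IsMarkovChain P X Pr)
    {R δ L : ℝ} (hR : 0 < R) (hrR : ∀ x, r x ≤ R)
    (hδ : 0 < δ) (hδπ : ∀ x, δ ≤ π x) (hL : 64 * R ^ 2 ≤ L * eigenGap P π) {s t : ℕ} (hs : 1 ≤ s)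
    (ht : 1 ≤ t) :
    Pr.real {ω | (∑ k ∈ Finset.range s, r (X k ω)) / s ≤
      meanReward π r - √(L * Real.log t / s)} ≤ δ⁻¹ * (1 / (t : ℝ) ^ 3) := by
  have hs' : (0 : ℝ) < s := by exact_mod_cast hs
  refine le_trans (measureReal_mono fun ω hω => ?_) (h.real_sum_ge_radius_le hX
    (f := fun x => meanReward π r - r x) ?_ hR
    (fun x => abs_sub_comm (r x) _ ▸ h.abs_sub_meanReward_le hrR x) hδ hδπ hL hs ht)
  · simp only [Set.mem_ofPred_eq, Finset.sum_sub_distrib, Finset.sum_const, Finset.card_range,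
      nsmul_eq_mul] at hω ⊢
    rw [div_le_iff₀ hs'] at hω
    linarith
  · simp_rw [mul_sub]
    rw [Finset.sum_sub_distrib, ← Finset.sum_mul, h.stationary.sum_eq_one, one_mul, meanReward,
      sub_eq_zero]
    exact Finset.sum_congr rfl fun x _ => mul_comm _ _

end Deviation

/-! ### Play counts of suboptimal arms under UCB-M -/

section UCB

variable {K : ℕ} {S : Fin K → Type*} {Ξ : Type*} [MeasurableSpace Ξ] {α : Policy S Ξ}
  {r : ∀ i, S i → ℝ} {M : ℕ} {L : ℝ}

/-- The plays of an arm, up to the initial `K` slots, its first `l` plays, and the later ones. -/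
lemma plays_le_add_sum (α : Policy S Ξ) (u : Ξ) (x : ∀ i, ℕ → S i) (i : Fin K) (l n : ℕ) :
    plays α u x n i ≤ K + l + ∑ t ∈ Finset.range n,
      if K ≤ t ∧ i ∈ played α u x t ∧ l ≤ plays α u x t i then 1 else 0 := by
  induction n with
  | zero => simp [plays_zero]
  | succ n ih =>
    rw [Finset.sum_range_succ]
    have h1 := plays_le α u x (n + 1) i
    have h2 := plays_succ α u x n i
    by_cases hp : i ∈ played α u x n
    · by_cases hK : K ≤ n
      · by_cases hl : l ≤ plays α u x n i
        · rw [if_pos ⟨hK, hp, hl⟩]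
          rw [if_pos hp] at h2
          omega
        · rw [if_pos hp] at h2
          omega
      · omega
    · rw [if_neg hp] at h2
      omega

/-- If UCB-M plays an arm `i ≥ M` that has been sampled often, then the sample mean of arm `i` is
too high or that of an arm `j < M` too low, by at least the confidence radius. -/
lemma IsUCBM.exists_deviation (hα : IsUCBM α r M L) (hM : 1 ≤ M) (hMK : M ≤ K) (hL : 0 ≤ L)
    {μ : Fin K → ℝ} {Δ : ℝ} (hΔ : 0 < Δ) {i : Fin K} (hi : M ≤ i.val)
    (hgap : ∀ j : Fin K, j.val < M → Δ ≤ μ j - μ i) (u : Ξ) (x : ∀ i, ℕ → S i) {t n : ℕ}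
    (hKt : K ≤ t) (htn : t ≤ n) (hplayed : i ∈ played α u x t)
    (hl : 4 * L * Real.log n / Δ ^ 2 ≤ plays α u x t i) :
    ∃ s ∈ Finset.Icc 1 t, μ i + √(L * Real.log t / s) ≤ sampleMean r x i s ∨
      ∃ j : Fin K, j.val < M ∧ sampleMean r x j s ≤ μ j - √(L * Real.log t / s) := by
  have hT : ∀ j, plays α u x t j ∈ Finset.Icc 1 t := fun j => by
    rw [Finset.mem_Icc]
    have h1 := plays_mono α u x j hKt
    simp only [hα.initial] at h1
    exact ⟨hM.trans h1, plays_le α u x t j⟩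
  obtain ⟨j, hjM, hj⟩ : ∃ j : Fin K, j.val < M ∧ j ∉ played α u x t := by
    by_contra! hall
    have hsub : (Finset.univ.filter fun j : Fin K => j.val < M) ⊆ played α u x t := fun j hj =>
      hall j (Finset.mem_filter.1 hj).2
    have hcard : (Finset.univ.filter fun j : Fin K => j.val < M).card = M := by
      rw [Fin.card_filter_val_lt]; simp [hMK]
    have := Finset.eq_of_subset_of_card_le hsub (by rw [hcard, hα.card_played])
    rw [← this] at hplayed
    exact absurd (Finset.mem_filter.1 hplayed).2 (by omega)
  have hidx := hα.highest u x t hKt i hplayed j hj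
  simp only [ucbIndex] at hidx
  by_cases hup : μ i + √(L * Real.log t / plays α u x t i) ≤ sampleMean r x i (plays α u x t i)
  · exact ⟨_, hT i, Or.inl hup⟩
  by_cases hlow : sampleMean r x j (plays α u x t j) ≤
      μ j - √(L * Real.log t / plays α u x t j)
  · exact ⟨_, hT j, Or.inr ⟨j, hjM, hlow⟩⟩
  exfalso
  have hTi : (0 : ℝ) < plays α u x t i := by exact_mod_cast (Finset.mem_Icc.1 (hT i)).1
  have ht0 : (0 : ℝ) < t := by
    have := i.2
    exact_mod_cast (show 0 < t by omega)
  have hlog : Real.log t ≤ Real.log n := Real.log_le_log ht0 (by exact_mod_cast htn)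
  have hrad : √(L * Real.log t / plays α u x t i) ≤ Δ / 2 := by
    rw [Real.sqrt_le_iff]
    refine ⟨by positivity, ?_⟩
    rw [div_le_iff₀ (by positivity)] at hl
    rw [div_le_iff₀ hTi]
    have := mul_le_mul_of_nonneg_left hlog hL
    nlinarith
  linarith [hgap j hjM]

variable [∀ i, Fintype (S i)] [∀ i, DecidableEq (S i)]
  [∀ i, MeasurableSpace (S i)] [∀ i, DiscreteMeasurableSpace (S i)]
  {Ω : Type*} [MeasurableSpace Ω] {Pr : Measure Ω} [IsProbabilityMeasure Pr]
  {P : ∀ i, Matrix (S i) (S i) ℝ} {π : ∀ i, S i → ℝ} {X : ∀ i, ℕ → Ω → S i} {ξ : Ω → Ξ}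

/-- The expected number of plays of an arm `i ≥ M` whose mean is at least `Δ` below those of the
first `M` arms. The union bound runs over the sample sizes `s ≤ t` and over arm `i` and the arms
`j < M`, since the play counts at time `t` are random. -/
lemma IsUCBM.integral_plays_le (hα : IsUCBM α r M L) (hm : IsBanditModel P X ξ Pr)
    (harm : ∀ i, ArmCondition (P i) (π i) (r i)) (hM : 1 ≤ M) (hMK : M ≤ K)
    {R δ : ℝ} (hR : 0 < R) (hrR : ∀ i x, r i x ≤ R) (hδ : 0 < δ) (hδπ : ∀ i x, δ ≤ π i x)
    (hL0 : 0 ≤ L) (hL : ∀ i, 64 * R ^ 2 ≤ L * eigenGap (P i) (π i)) {Δ : ℝ} (hΔ : 0 < Δ)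
    {i : Fin K} (hi : M ≤ i.val)
    (hgap : ∀ j : Fin K, j.val < M →
      Δ ≤ meanReward (π j) (r j) - meanReward (π i) (r i)) (n : ℕ) :
    ∫ ω, (plays α (ξ ω) (fun i s => X i s ω) n i : ℝ) ∂Pr ≤
      4 * L * Real.log n / Δ ^ 2 + (K + 1 + (K + 1) * δ⁻¹ * ∑' t : ℕ, 1 / (t : ℝ) ^ 2) := by
  set μ : Fin K → ℝ := fun i => meanReward (π i) (r i) with hμ
  set l := ⌈4 * L * Real.log n / Δ ^ 2⌉₊ with hl
  have hlog : 0 ≤ Real.log n := Real.log_natCast_nonneg n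
  have hl_le : (l : ℝ) ≤ 4 * L * Real.log n / Δ ^ 2 + 1 :=
    (Nat.ceil_lt_add_one (by positivity)).le
  let U : ℕ → ℕ → Set Ω := fun t s =>
    {ω | μ i + √(L * Real.log t / s) ≤ (∑ k ∈ Finset.range s, r i (X i k ω)) / s}
  let V : ℕ → ℕ → Fin K → Set Ω := fun t s j =>
    {ω | (∑ k ∈ Finset.range s, r j (X j k ω)) / s ≤ μ j - √(L * Real.log t / s)}
  let F := Finset.univ.filter fun j : Fin K => j.val < M
  have hFcard : (F.card : ℝ) ≤ K := by
    exact_mod_cast (Finset.card_le_univ F).trans (Fintype.card_fin K).le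
  let E : ℕ → Set (Ξ × ∀ i, ℕ → S i) := fun t =>
    {p | K ≤ t ∧ i ∈ played α p.1 p.2 t ∧ l ≤ plays α p.1 p.2 t i}
  have hE : ∀ t, MeasurableSet (E t) := fun t =>
    (MeasurableSet.const (K ≤ t)).inter ((measurableSet_mem_played α t i).inter
      (measurable_plays α t i (measurableSet_Ici (a := l))))
  let Y : Ω → Ξ × ∀ i, ℕ → S i := fun ω => (ξ ω, fun i s => X i s ω)
  have hY : Measurable Y := hm.measurable_seed_paths
  have hprob : ∀ t < n, Pr.real (Y ⁻¹' E t) ≤ (K + 1) * δ⁻¹ * (1 / (t : ℝ) ^ 2) := by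
    intro t htn
    by_cases hKt : K ≤ t
    · have ht : 1 ≤ t := by omega
      have hsub : Y ⁻¹' E t ⊆ ⋃ s ∈ Finset.Icc 1 t, (U t s ∪ ⋃ j ∈ F, V t s j) := by
        rintro ω ⟨-, h1, h2⟩
        have h3 : 4 * L * Real.log n / Δ ^ 2 ≤
            (plays α (ξ ω) (fun i s => X i s ω) t i : ℝ) :=
          (Nat.le_ceil _).trans (by exact_mod_cast h2)
        obtain ⟨s, hs, h4⟩ := hα.exists_deviation hM hMK hL0 hΔ hi hgap (ξ ω)
          (fun i s => X i s ω) hKt htn.le h1 h3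
        refine Set.mem_biUnion hs ?_
        rcases h4 with h4 | ⟨j, hj, h4⟩
        · exact Or.inl h4
        · exact Or.inr (Set.mem_biUnion (Finset.mem_filter.2 ⟨Finset.mem_univ j, hj⟩) h4)
      have hone : ∀ s ∈ Finset.Icc 1 t, Pr.real (U t s ∪ ⋃ j ∈ F, V t s j) ≤
          (K + 1) * (δ⁻¹ * (1 / (t : ℝ) ^ 3)) := by
        intro s hs
        have hs1 := (Finset.mem_Icc.1 hs).1
        have h1 : Pr.real (U t s) ≤ δ⁻¹ * (1 / (t : ℝ) ^ 3) :=
          (harm i).real_mean_ge_le (hm.chain i) hR (hrR i) hδ (hδπ i) (hL i) hs1 ht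
        have h2 : Pr.real (⋃ j ∈ F, V t s j) ≤ K * (δ⁻¹ * (1 / (t : ℝ) ^ 3)) :=
          calc _ ≤ ∑ j ∈ F, Pr.real (V t s j) := measureReal_biUnion_finset_le _ _
            _ ≤ ∑ j ∈ F, δ⁻¹ * (1 / (t : ℝ) ^ 3) := Finset.sum_le_sum fun j _ =>
              (harm j).real_mean_le_le (hm.chain j) hR (hrR j) hδ (hδπ j) (hL j) hs1 ht
            _ = F.card * (δ⁻¹ * (1 / (t : ℝ) ^ 3)) := by simp
            _ ≤ _ := by gcongr
        linarith [measureReal_union_le (μ := Pr) (U t s) (⋃ j ∈ F, V t s j)]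
      calc _ ≤ Pr.real (⋃ s ∈ Finset.Icc 1 t, (U t s ∪ ⋃ j ∈ F, V t s j)) :=
          measureReal_mono hsub (measure_ne_top _ _)
        _ ≤ ∑ s ∈ Finset.Icc 1 t, Pr.real (U t s ∪ ⋃ j ∈ F, V t s j) :=
          measureReal_biUnion_finset_le _ _
        _ ≤ ∑ s ∈ Finset.Icc 1 t, (K + 1) * (δ⁻¹ * (1 / (t : ℝ) ^ 3)) := Finset.sum_le_sum hone
        _ = t * ((K + 1) * (δ⁻¹ * (1 / (t : ℝ) ^ 3))) := by simp
        _ = _ := by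
          have : (t : ℝ) ≠ 0 := by exact_mod_cast (by omega : t ≠ 0)
          field_simp
    · have : Y ⁻¹' E t = ∅ := by
        ext ω
        simp only [Set.mem_empty_iff_false, iff_false]
        exact fun h => hKt h.1
      rw [this, measureReal_empty]
      positivity
  have hind : ∀ t, Integrable ((Y ⁻¹' E t).indicator fun _ => (1 : ℝ)) Pr := fun t =>
    (integrable_const _).indicator (hY (hE t))
  calc ∫ ω, (plays α (ξ ω) (fun i s => X i s ω) n i : ℝ) ∂Pr
      ≤ ∫ ω, ((K : ℝ) + l + ∑ t ∈ Finset.range n,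
          (Y ⁻¹' E t).indicator (fun _ => (1 : ℝ)) ω) ∂Pr := by
        refine integral_mono (hm.integrable_plays α n i)
          ((integrable_const _).add (integrable_finsetSum _ fun t _ => hind t)) fun ω => ?_
        have h1 := plays_le_add_sum α (ξ ω) (fun i s => X i s ω) i l n
        have h2 : (plays α (ξ ω) (fun i s => X i s ω) n i : ℝ) ≤
            (K : ℝ) + l + ∑ t ∈ Finset.range n, if K ≤ t ∧ i ∈ played α (ξ ω)
              (fun i s => X i s ω) t ∧ l ≤ plays α (ξ ω) (fun i s => X i s ω) t i
              then (1 : ℝ) else 0 := by exact_mod_cast h1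
        refine h2.trans (le_of_eq ?_)
        simp only [Set.indicator, Y, E, Set.mem_preimage, Set.mem_ofPred_eq]
    _ = (K : ℝ) + l + ∑ t ∈ Finset.range n, Pr.real (Y ⁻¹' E t) := by
        rw [integral_add (integrable_const _) (integrable_finsetSum _ fun t _ => hind t),
          integral_finsetSum _ fun t _ => hind t]
        simp [integral_indicator_const _ (hY (hE _))]
    _ ≤ (K : ℝ) + l + ∑ t ∈ Finset.range n, (K + 1) * δ⁻¹ * (1 / (t : ℝ) ^ 2) := by
        gcongr with t ht
        exact hprob t (Finset.mem_range.1 ht)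
    _ ≤ (K : ℝ) + l + (K + 1) * δ⁻¹ * ∑' t : ℕ, 1 / (t : ℝ) ^ 2 := by
        rw [← Finset.mul_sum]
        gcongr
        exact (Real.summable_one_div_nat_pow.2 one_lt_two).sum_le_tsum _
          fun t _ => by positivity
    _ ≤ _ := by linarith

end UCB

/-! ### The constants -/

section ConstantBounds

variable {K : ℕ} {S : Fin K → Type*} [∀ i, Fintype (S i)] [∀ i, DecidableEq (S i)]
  {P : ∀ i, Matrix (S i) (S i) ℝ} {π r : ∀ i, S i → ℝ}

lemma ArmCondition.nonempty {S : Type*} [Fintype S] [DecidableEq S] {P : Matrix S S ℝ}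
    {π r : S → ℝ} (h : ArmCondition P π r) : Nonempty S := by
  by_contra hne
  rw [not_nonempty_iff] at hne
  simpa using h.stationary.sum_eq_one

omit [∀ i, DecidableEq (S i)] in
lemma piMin_le (π : ∀ i, S i → ℝ) (i : Fin K) (x : S i) : piMin π ≤ π i x :=
  ciInf_le (Set.finite_range _).bddBelow (⟨i, x⟩ : Σ i, S i)

lemma piMin_pos (harm : ∀ i, ArmCondition (P i) (π i) (r i)) (hK : 0 < K) : 0 < piMin π := by
  obtain ⟨x⟩ := (harm ⟨0, hK⟩).nonempty
  have : Nonempty (Σ i, S i) := ⟨⟨_, x⟩⟩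
  obtain ⟨p, hp⟩ := exists_eq_ciInf_of_finite (f := fun p : Σ i, S i => π p.1 p.2)
  rw [piMin, ← hp]
  exact (harm p.1).pi_pos p.2

omit [∀ i, DecidableEq (S i)] in
lemma le_rMax (r : ∀ i, S i → ℝ) (i : Fin K) (x : S i) : r i x ≤ rMax r :=
  le_ciSup (f := fun p : Σ i, S i => r p.1 p.2) (Set.finite_range _).bddAbove ⟨i, x⟩

lemma epsMin_le (P : ∀ i, Matrix (S i) (S i) ℝ) (π : ∀ i, S i → ℝ) (i : Fin K) :
    epsMin P π ≤ eigenGap (P i) (π i) :=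
  ciInf_le (Set.finite_range _).bddBelow i

lemma epsMin_pos (harm : ∀ i, ArmCondition (P i) (π i) (r i)) (hK : 0 < K) : 0 < epsMin P π := by
  have : Nonempty (Fin K) := ⟨⟨0, hK⟩⟩
  obtain ⟨i, hi⟩ := exists_eq_ciInf_of_finite (f := fun i => eigenGap (P i) (π i))
  rw [epsMin, ← hi]
  exact (harm i).eigenGap_pos

/-- `1 = ∑ x, π x ≤ |S| π̂_max`. -/
lemma one_le_sMax_mul_piHatMax (harm : ∀ i, ArmCondition (P i) (π i) (r i)) (hK : 0 < K) :
    1 ≤ (sMax S : ℝ) * piHatMax π := by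
  let i : Fin K := ⟨0, hK⟩
  have h1 : ∀ x : S i, π i x ≤ piHatMax π := fun x =>
    (le_max_left _ _).trans (le_ciSup (f := fun p : Σ i, S i => max (π p.1 p.2) (1 - π p.1 p.2))
      (Set.finite_range _).bddAbove ⟨i, x⟩)
  obtain ⟨x0⟩ := (harm i).nonempty
  have h2 : 0 ≤ piHatMax π := ((harm i).pi_pos x0).le.trans (h1 x0)
  have h3 : (Fintype.card (S i) : ℝ) ≤ sMax S := by
    exact_mod_cast Finset.le_sup (f := fun i => Fintype.card (S i)) (Finset.mem_univ i)
  calc (1 : ℝ) = ∑ x, π i x := (harm i).stationary.sum_eq_one.symm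
    _ ≤ ∑ _x : S i, piHatMax π := Finset.sum_le_sum fun x _ => h1 x
    _ = Fintype.card (S i) * piHatMax π := by simp
    _ ≤ _ := by gcongr

lemma le_mul_eigenGap_of_le (harm : ∀ i, ArmCondition (P i) (π i) (r i)) (hK : 0 < K) {L : ℝ}
    (hL : 112 * (sMax S : ℝ) ^ 2 * rMax r ^ 2 * piHatMax π ^ 2 / epsMin P π ≤ L) :
    0 ≤ L ∧ ∀ i, 64 * rMax r ^ 2 ≤ L * eigenGap (P i) (π i) := by
  have hε := epsMin_pos harm hK
  have hL0 : 0 ≤ L := le_trans (by positivity) hL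
  refine ⟨hL0, fun i => ?_⟩
  rw [div_le_iff₀ hε] at hL
  have h1 : 1 ≤ ((sMax S : ℝ) * piHatMax π) ^ 2 :=
    one_le_pow₀ (one_le_sMax_mul_piHatMax harm hK)
  have h2 := mul_le_mul_of_nonneg_left (epsMin_le P π i) hL0
  nlinarith [sq_nonneg (rMax r), mul_le_mul_of_nonneg_left h1 (sq_nonneg (rMax r))]

omit [∀ i, DecidableEq (S i)] in
lemma pairConst_nonneg (hπ : ∀ i x, 0 ≤ π i x) (i j : Fin K) : 0 ≤ pairConst π i j := by
  have h1 : 0 ≤ beta := tsum_nonneg fun t => by positivity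
  have h2 : 0 ≤ piMin π := Real.iInf_nonneg fun p => hπ p.1 p.2
  unfold pairConst
  positivity

end ConstantBounds

end MarkovBandit

/-! ### The regret bound -/

theorem mainTheorem1 {K : ℕ} (S : Fin K → Type*) [∀ i, Fintype (S i)] [∀ i, DecidableEq (S i)]
    [∀ i, MeasurableSpace (S i)] [∀ i, DiscreteMeasurableSpace (S i)]
    (P : ∀ i, Matrix (S i) (S i) ℝ) (π r : ∀ i, S i → ℝ)
    (harm : ∀ i, MarkovBandit.ArmCondition (P i) (π i) (r i))
    (hanti : Antitone fun i => MarkovBandit.meanReward (π i) (r i)) :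
    ∃ C : ℝ, ∀ (M : ℕ) (hM : 1 ≤ M) (hMK : M ≤ K),
      (∀ i j : Fin K, i.val < M → M ≤ j.val →
        MarkovBandit.meanReward (π j) (r j) < MarkovBandit.meanReward (π i) (r i)) →
      ∀ L : ℝ,
        112 * (MarkovBandit.sMax S : ℝ) ^ 2 * MarkovBandit.rMax r ^ 2 *
          MarkovBandit.piHatMax π ^ 2 / MarkovBandit.epsMin P π ≤ L →
      ∀ (Ω : Type*) (_ : MeasurableSpace Ω) (Pr : Measure Ω) (_ : IsProbabilityMeasure Pr)
        (Ξ : Type*) (_ : MeasurableSpace Ξ) (X : ∀ i, ℕ → Ω → S i) (ξ : Ω → Ξ)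
        (α : MarkovBandit.Policy S Ξ),
        MarkovBandit.IsBanditModel P X ξ Pr → MarkovBandit.IsUCBM α r M L →
        ∀ n : ℕ, 1 ≤ n →
          MarkovBandit.regret α π r X ξ Pr M n ≤
            4 * L * Real.log n *
              ∑ i : Fin K with M ≤ i.val,
                (MarkovBandit.meanReward (π ⟨0, by omega⟩) (r ⟨0, by omega⟩) -
                    MarkovBandit.meanReward (π i) (r i)) /
                  (MarkovBandit.meanReward (π ⟨M - 1, by omega⟩) (r ⟨M - 1, by omega⟩) -
                    MarkovBandit.meanReward (π i) (r i)) ^ 2 +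
            ∑ i : Fin K with M ≤ i.val,
              (MarkovBandit.meanReward (π ⟨0, by omega⟩) (r ⟨0, by omega⟩) -
                  MarkovBandit.meanReward (π i) (r i)) *
                (M + ∑ j : Fin K with j.val < M, MarkovBandit.pairConst π i j) +
            C := by

  rcases Nat.eq_zero_or_pos K with hK0 | hK
  · exact ⟨0, fun M hM hMK => by omega⟩
  set μ : Fin K → ℝ := fun i => MarkovBandit.meanReward (π i) (r i) with hμ
  have hpois : ∀ i, ∃ h : S i → ℝ, ∀ y, r i y - μ i = h y - (P i).mulVec h y := fun i => by
    refine (harm i).exists_poisson ?_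
    simp_rw [mul_sub]
    rw [Finset.sum_sub_distrib, ← Finset.sum_mul, (harm i).stationary.sum_eq_one, one_mul,
      sub_eq_zero]
    exact Finset.sum_congr rfl fun x _ => mul_comm _ _
  choose h hp using hpois
  have hbd : ∀ i, ∃ c : ℝ, ∀ y, |h i y| ≤ c := fun i => by
    obtain ⟨c, hc⟩ := (Set.finite_range fun y => |h i y|).bddAbove
    exact ⟨c, fun y => hc ⟨y, rfl⟩⟩
  choose c hc using hbd
  set δ := MarkovBandit.piMin π with hδdef
  have hδ : 0 < δ := MarkovBandit.piMin_pos harm hK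
  set B : ℝ := K + 1 + (K + 1) * δ⁻¹ * ∑' t : ℕ, 1 / (t : ℝ) ^ 2 with hB
  have hB0 : 0 ≤ B := by
    have : 0 ≤ ∑' t : ℕ, 1 / (t : ℝ) ^ 2 := tsum_nonneg fun t => by positivity
    positivity
  set μ0 := μ ⟨0, hK⟩ with hμ0
  have hμle : ∀ i, μ i ≤ μ0 := fun i => hanti (Fin.mk_le_of_le_val (Nat.zero_le _))
  refine ⟨∑ i, (μ0 - μ i) * B + ∑ i, 2 * c i, ?_⟩
  intro M hM hMK hgap L hL Ω _ Pr _ Ξ _ X ξ α hm hα n hn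
  obtain ⟨hL0, hLε⟩ := MarkovBandit.le_mul_eigenGap_of_le harm hK hL
  have hR : 0 < MarkovBandit.rMax r := by
    obtain ⟨x⟩ := (harm ⟨0, hK⟩).nonempty
    exact ((harm _).reward_pos x).trans_le (MarkovBandit.le_rMax r _ x)
  have hreg := hm.regret_le α hMK hα.card_played hp hc hμle n
  set μM := μ ⟨M - 1, by omega⟩ with hμM
  have hplays : ∀ i : Fin K, M ≤ i.val →
      ∫ ω, (MarkovBandit.plays α (ξ ω) (fun i s => X i s ω) n i : ℝ) ∂Pr ≤
        4 * L * Real.log n / (μM - μ i) ^ 2 + B := fun i hi => by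
    refine hα.integral_plays_le hm harm hM hMK hR (MarkovBandit.le_rMax r) hδ
      (MarkovBandit.piMin_le π) hL0 hLε (sub_pos.2 (hgap _ i ?_ hi)) hi (fun j hj => ?_) n
    · change M - 1 < M
      omega
    · have : μM ≤ μ j := hanti (Fin.le_def.2 (by change j.val ≤ M - 1; omega))
      change μM - μ i ≤ μ j - μ i
      linarith
  -- the second sum of the bound is nonnegative, so that it may be added freely
  have hpair : 0 ≤ ∑ i : Fin K with M ≤ i.val, (μ0 - μ i) *
      (M + ∑ j : Fin K with j.val < M, MarkovBandit.pairConst π i j) :=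
    Finset.sum_nonneg fun i _ => mul_nonneg (sub_nonneg.2 (hμle i))
      (add_nonneg (Nat.cast_nonneg M) (Finset.sum_nonneg fun j _ =>
        MarkovBandit.pairConst_nonneg (fun i x => ((harm i).pi_pos x).le) i j))
  have hmain : ∑ i : Fin K with M ≤ i.val, (μ0 - μ i) *
        ∫ ω, (MarkovBandit.plays α (ξ ω) (fun i s => X i s ω) n i : ℝ) ∂Pr ≤
      4 * L * Real.log n * ∑ i : Fin K with M ≤ i.val, (μ0 - μ i) / (μM - μ i) ^ 2 +
        ∑ i, (μ0 - μ i) * B := by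
    calc _ ≤ ∑ i : Fin K with M ≤ i.val,
          (4 * L * Real.log n * ((μ0 - μ i) / (μM - μ i) ^ 2) + (μ0 - μ i) * B) := by
          refine Finset.sum_le_sum fun i hi => ?_
          have h1 := mul_le_mul_of_nonneg_left (hplays i (Finset.mem_filter.1 hi).2)
            (sub_nonneg.2 (hμle i))
          refine h1.trans (le_of_eq ?_)
          ring
      _ ≤ _ := by
          rw [Finset.sum_add_distrib, ← Finset.mul_sum]
          have hle : ∑ i : Fin K with M ≤ i.val, (μ0 - μ i) * B ≤ ∑ i, (μ0 - μ i) * B :=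
            Finset.sum_le_sum_of_subset_of_nonneg (Finset.filter_subset _ _)
              fun i _ _ => mul_nonneg (sub_nonneg.2 (hμle i)) hB0
          linarith
  have := add_le_add hmain hpair
  calc _ ≤ _ := hreg
    _ ≤ 4 * L * Real.log n * ∑ i : Fin K with M ≤ i.val, (μ0 - μ i) / (μM - μ i) ^ 2 +
        ∑ i : Fin K with M ≤ i.val, (μ0 - μ i) *
          (M + ∑ j : Fin K with j.val < M, MarkovBandit.pairConst π i j) +
        (∑ i, (μ0 - μ i) * B + ∑ i, 2 * c i) := by
      linarith
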